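/- \textbf{Theorem (Soundness).} Let $\mathsf{PCFL}_\oplus$ be the following typed probabilistic call-by-value $\lambda$-calculus with lazy pairs and lists, over a finite set $\mathcal O$ of binary operators on $\mathbb N$ (each with a semantics $\overline{\mathsf{op}}:\mathbb N\times\mathbb N\to X$ and result type $\gamma_{\mathsf{op}}=\mathbf{int}$ if $X=\mathbb N$, $\gamma_{\mathsf{op}}=\mathbf{bool}$ if $X=\{\mathsf{true},\mathsf{false}\}$) containing $+,\le,=$. \emph{Syntax.} Types are $\sigma::=\mathbf{bool}\mid\mathbf{int}\mid\sigma\to\sigma\mid\sigma\times\sigma\mid[\sigma]$. Terms, taken modulo $\alpha$-equivalence, are $$M::=x\mid\underline n\mid\underline b\mid\mathsf{nil}\mid\langle M,M\rangle\mid M::M\mid\lambda x.M\mid\mathsf{fix}\,x.M\mid M\oplus M\mid\mathsf{if}\,M\,\mathsf{then}\,M\,\mathsf{else}\,M\mid\mathsf{op}(M,M)\mid\mathsf{fst}\,M\mid\mathsf{snd}\,M\mid\mathsf{case}\,M\,\mathsf{of}\,\{\mathsf{nil}\to M\mid h::t\to M\}\mid M\,M$$ with $n\in\mathbb N$, $b\in\{\mathsf{true},\mathsf{false}\}$,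 $\mathsf{op}\in\mathcal O$. The judgement $\Gamma\vdash M:\sigma$ is given by the usual simple type assignment rules; both arguments of $\mathsf{op}$ have type $\mathbf{int}$ and the result has type $\gamma_{\mathsf{op}}$; $\Gamma\vdash M\oplus N:\sigma$ if $\Gamma\vdash M:\sigma$ and $\Gamma\vdash N:\sigma$; and $\Gamma\vdash\mathsf{fix}\,x.M:\sigma\to\tau$ if $\Gamma,x:\sigma\to\tau\vdash M:\sigma\to\tau$. Values are the terms $\underline n,\underline b,\mathsf{nil},\lambda x.M,\mathsf{fix}\,x.M,M::N,\langle M,N\rangle$. \emph{Semantics.} $M\Downarrow\mathscr D$ (with $\mathscr D$ a finitely supported subprobability distribution on values) is defined inductively, where all families of premises and all sums range over supports and $\delta_V$ is the point mass at $V$: \begin{itemize} \item $M\Downarrow 0$; and $V\Downarrow\delta_V$ for $V$ a value; \item if $M\Downarrow\mathscr D$, $N\Downarrow\mathscr E$, then $\mathsf{op}(M,N)\Downarrow\sum_{n,m}\mathscr D(\underline n)\mathscr E(\underline m)\,\delta_{\underline{\overline{\mathsf{op}}(n,m)}}$; \item if $M\Downarrow\mathscr K$, $N\Downarrow\mathscr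 F$, $P\{V/x\}\Downarrow\mathscr E_{P,V}$ and $Q\{\mathsf{fix}\,x.Q/x\}\,V\Downarrow\mathscr G_{Q,V}$, then $MN\Downarrow\sum_V\mathscr F(V)\bigl(\sum_P\mathscr K(\lambda x.P)\mathscr E_{P,V}+\sum_Q\mathscr K(\mathsf{fix}\,x.Q)\mathscr G_{Q,V}\bigr)$; \item if $L\Downarrow\mathscr D$, $M_1\Downarrow\mathscr E_1$, $M_2\Downarrow\mathscr E_2$, then $\mathsf{if}\,L\,\mathsf{then}\,M_1\,\mathsf{else}\,M_2\Downarrow\mathscr D(\underline{\mathsf{true}})\mathscr E_1+\mathscr D(\underline{\mathsf{false}})\mathscr E_2$; \item if $L\Downarrow\mathscr D$, $M_1\Downarrow\mathscr E$, $H\Downarrow\mathscr G_{H,T}$, $T\Downarrow\mathscr K_{H,T}$ and $M_2\{V/h,W/t\}\Downarrow\mathscr F_{V,W}$, then $\mathsf{case}\,L\,\mathsf{of}\,\{\mathsf{nil}\to M_1\mid h::t\to M_2\}\Downarrow\mathscr D(\mathsf{nil})\mathscr E+\sum_{H,T}\sum_{V,W}\mathscr D(H::T)\mathscr G_{H,T}(V)\mathscr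 K_{H,T}(W)\mathscr F_{V,W}$; \item if $M\Downarrow\mathscr D$ and $P\Downarrow\mathscr E_P$, then $\mathsf{fst}\,M\Downarrow\sum_{P,N}\mathscr D(\langle P,N\rangle)\mathscr E_P$; symmetrically for $\mathsf{snd}$; \item if $M_1\Downarrow\mathscr D_1$, $M_2\Downarrow\mathscr D_2$, then $M_1\oplus M_2\Downarrow\frac12\mathscr D_1+\frac12\mathscr D_2$. \end{itemize} Put $[\![M]\!]=\sup\{\mathscr D\mid M\Downarrow\mathscr D\}$ (pointwise). \emph{Typed relations.} A typed relation is a family $\mathcal R=(\mathcal R^\Gamma_\sigma)$ with $\mathcal R^\Gamma_\sigma$ a binary relation on the terms of type $\sigma$ under $\Gamma$. It is compatible if it relates each variable and each constant to itself and is preserved by all term constructors (for binders, from the extended typing context); it is a precongruence if it is transitive and compatible, and a congruence if it is moreover symmetric. The contextual preorder $\le$ relates $M$ and $N$, both of type $\tau$ under $\Gamma$, if $\sum_V[\![C[M]]\!](V)\le\sum_V[\![C[N]]\!](V)$ for every one-hole context $C$, of any result type, that is typed under the empty typing context and whose hole has type $\tau$ under $\Gamma$ (so that $C$ captures the variables of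 $\Gamma$). Context equivalence is $\equiv\;=\;\le\cap\ge$. \emph{Simulation.} In a labelled Markov chain with countable state space $\mathcal S$ and sub-stochastic transition matrix $\mathcal P$, a probabilistic simulation is a preorder $R$ on $\mathcal S$ such that $s\,R\,t$ implies $\mathcal P(s,l,X)\le\mathcal P(t,l,R(X))$ for all labels $l$ and all $X\subseteq\mathcal S$; a probabilistic bisimulation is an equivalence relation $R$ such that $s\,R\,t$ implies $\mathcal P(s,l,E)=\mathcal P(t,l,E)$ for all $l$ and all equivalence classes $E$ of $R$. Similarity $\precsim$ and bisimilarity $\backsim$ are the unions of all simulations and of all bisimulations, respectively. Consider the chain whose states are the pairs $(M,\sigma)$ with $\emptyset\vdash M:\sigma$ and, disjointly, the pairs $(\hat V,\sigma)$ with $V$ a value and $\emptyset\vdash V:\sigma$, and whose transitions are as follows: every state with second component $\sigma$ moves to itself with probability $1$ under the label $\sigma$; $(M,\sigma)$ moves to $(\hat V,\sigma)$ under $\mathit{eval}$ with probability $[\![M]\!](V)$; and, with probability $1$, for each closed value $W$ of type $\tau$ as a label, $(\widehat{\lambda x.M},\tau\to\theta)$ moves to $(M\{W/x\},\theta)$ and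 $(\widehat{\mathsf{fix}\,x.M},\tau\to\theta)$ moves to $(M\{\mathsf{fix}\,x.M/x\}\,W,\theta)$; $(\widehat{\langle M,N\rangle},\tau\times\theta)$ moves to $(M,\tau)$ under $\mathit{fst}$ and to $(N,\theta)$ under $\mathit{snd}$; $(\hat{\underline k},\mathbf{int})$, $(\hat{\underline b},\mathbf{bool})$ and $(\widehat{\mathsf{nil}},[\tau])$ move to themselves under the respective labels $k$, $b$, $\mathit{nil}$; $(\widehat{M::N},[\tau])$ moves to $(M,\tau)$ under $\mathit{hd}$ and to $(N,[\tau])$ under $\mathit{tl}$; all other probabilities are $0$. The simulation preorder $\precsim_\circ$ is the typed relation that relates $M$ and $N$, both of type $\sigma$ under $\Gamma$, iff $(M\xi,\sigma)\precsim(N\xi,\sigma)$ for every substitution $\xi$ of closed values of the right types for the variables of $\Gamma$; bisimulation equivalence $\backsim_\circ$ is defined likewise from $\backsim$. \emph{Claim.} The typed relation $\precsim_\circ$ is a precongruence and is included in $\le$. Likewise, $\backsim_\circ$ is a congruence and is included in $\equiv$. -/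

import Mathlib

open scoped ENNReal

namespace PCFL

/-! ### Types, operators, terms -/

/-- Types: `bool`, `int`, function types, product types and list types. -/
inductive Ty : Type
  | bool : Ty
  | int : Ty
  | arr : Ty → Ty → Ty
  | prod : Ty → Ty → Ty
  | list : Ty → Ty
  deriving Countable

/-- The semantics of a binary operator on natural numbers, with result type `int` or `bool`. -/
inductive OpSem : Type
  | toNat : (ℕ → ℕ → ℕ) → OpSem
  | toBool : (ℕ → ℕ → Bool) → OpSem

/-- The set of operator symbols: any finite set of binary operators on natural numbers, each with
its result type and its semantics, that includes at least `+`, `≤` and `=`. -/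
structure Signature where
  Op : Type
  finite : Finite Op
  sem : Op → OpSem
  plus : Op
  leq : Op
  eql : Op
  sem_plus : sem plus = OpSem.toNat (fun m n => m + n)
  sem_leq : sem leq = OpSem.toBool (fun m n => decide (m ≤ n))
  sem_eql : sem eql = OpSem.toBool (fun m n => decide (m = n))

/-- Raw (untyped) terms modulo α-equivalence, in de Bruijn notation. `lam M` and `fix M` bind the
variable `0` of `M`; `caseList L M N` binds in `N` the variable `0` (head) and the variable `1`
(tail). -/
inductive Tm (Op : Type) : Type
  | var : ℕ → Tm Op
  | num : ℕ → Tm Op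
  | bool : Bool → Tm Op
  | nil : Tm Op
  | pair : Tm Op → Tm Op → Tm Op
  | cons : Tm Op → Tm Op → Tm Op
  | lam : Tm Op → Tm Op
  | fix : Tm Op → Tm Op
  | choice : Tm Op → Tm Op → Tm Op
  | ite : Tm Op → Tm Op → Tm Op → Tm Op
  | op : Op → Tm Op → Tm Op → Tm Op
  | fst : Tm Op → Tm Op
  | snd : Tm Op → Tm Op
  | caseList : Tm Op → Tm Op → Tm Op → Tm Op
  | app : Tm Op → Tm Op → Tm Op
  deriving Countable

/-- The result type of an operator. -/
def OpSem.resTy : OpSem → Ty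
  | .toNat _ => .int
  | .toBool _ => .bool

/-- The constant denoting the result of an operator on two natural numbers. -/
def OpSem.result {Op : Type} : OpSem → ℕ → ℕ → Tm Op
  | .toNat f, m, n => .num (f m n)
  | .toBool f, m, n => .bool (f m n)

/-! ### Capture-avoiding substitution -/

/-- Extend a renaming under one binder. -/
def liftRen (ρ : ℕ → ℕ) : ℕ → ℕ
  | 0 => 0
  | n + 1 => ρ n + 1

/-- Renaming of the free variables. -/
def Tm.rename {Op : Type} : (ℕ → ℕ) → Tm Op → Tm Op
  | ρ, .var n => .var (ρ n)
  | _, .num n => .num n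
  | _, .bool b => .bool b
  | _, .nil => .nil
  | ρ, .pair M N => .pair (M.rename ρ) (N.rename ρ)
  | ρ, .cons M N => .cons (M.rename ρ) (N.rename ρ)
  | ρ, .lam M => .lam (M.rename (liftRen ρ))
  | ρ, .fix M => .fix (M.rename (liftRen ρ))
  | ρ, .choice M N => .choice (M.rename ρ) (N.rename ρ)
  | ρ, .ite L M N => .ite (L.rename ρ) (M.rename ρ) (N.rename ρ)
  | ρ, .op o M N => .op o (M.rename ρ) (N.rename ρ)
  | ρ, .fst M => .fst (M.rename ρ)
  | ρ, .snd M => .snd (M.rename ρ)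
  | ρ, .caseList L M N =>
      .caseList (L.rename ρ) (M.rename ρ) (N.rename (liftRen (liftRen ρ)))
  | ρ, .app M N => .app (M.rename ρ) (N.rename ρ)

/-- Extend a substitution under one binder. -/
def liftSub {Op : Type} (θ : ℕ → Tm Op) : ℕ → Tm Op
  | 0 => .var 0
  | n + 1 => (θ n).rename Nat.succ

/-- Simultaneous substitution for all free variables. -/
def Tm.subst {Op : Type} : (ℕ → Tm Op) → Tm Op → Tm Op
  | θ, .var n => θ n
  | _, .num n => .num n
  | _, .bool b => .bool b
  | _, .nil => .nil
  | θ, .pair M N => .pair (M.subst θ) (N.subst θ)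
  | θ, .cons M N => .cons (M.subst θ) (N.subst θ)
  | θ, .lam M => .lam (M.subst (liftSub θ))
  | θ, .fix M => .fix (M.subst (liftSub θ))
  | θ, .choice M N => .choice (M.subst θ) (N.subst θ)
  | θ, .ite L M N => .ite (L.subst θ) (M.subst θ) (N.subst θ)
  | θ, .op o M N => .op o (M.subst θ) (N.subst θ)
  | θ, .fst M => .fst (M.subst θ)
  | θ, .snd M => .snd (M.subst θ)
  | θ, .caseList L M N =>
      .caseList (L.subst θ) (M.subst θ) (N.subst (liftSub (liftSub θ)))
  | θ, .app M N => .app (M.subst θ) (N.subst θ)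

/-- `M{V/x}` where `x` is the variable `0` of `M`. -/
def Tm.inst {Op : Type} (M V : Tm Op) : Tm Op :=
  M.subst fun
    | 0 => V
    | n + 1 => .var n

/-- `M{V/h, W/t}` where `h`, `t` are the variables `0`, `1` of `M`. -/
def Tm.inst₂ {Op : Type} (M V W : Tm Op) : Tm Op :=
  M.subst fun
    | 0 => V
    | 1 => W
    | n + 2 => .var n

/-! ### Type assignment -/

/-- `HasType S Γ M σ` is the judgement `Γ ⊢ M : σ`. The `i`-th entry of the list `Γ` is the type of
the variable `i`. -/
inductive HasType (S : Signature) : List Ty → Tm S.Op → Ty → Prop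
  | var {Γ : List Ty} {i : ℕ} {σ : Ty} : Γ[i]? = some σ → HasType S Γ (.var i) σ
  | bool {Γ : List Ty} (b : Bool) : HasType S Γ (.bool b) .bool
  | num {Γ : List Ty} (n : ℕ) : HasType S Γ (.num n) .int
  | ite {Γ : List Ty} {L M N : Tm S.Op} {σ : Ty} :
      HasType S Γ L .bool → HasType S Γ M σ → HasType S Γ N σ → HasType S Γ (.ite L M N) σ
  | op {Γ : List Ty} {M N : Tm S.Op} (o : S.Op) :
      HasType S Γ M .int → HasType S Γ N .int → HasType S Γ (.op o M N) (S.sem o).resTy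
  | lam {Γ : List Ty} {M : Tm S.Op} {σ τ : Ty} :
      HasType S (σ :: Γ) M τ → HasType S Γ (.lam M) (.arr σ τ)
  | choice {Γ : List Ty} {M N : Tm S.Op} {σ : Ty} :
      HasType S Γ M σ → HasType S Γ N σ → HasType S Γ (.choice M N) σ
  | app {Γ : List Ty} {M N : Tm S.Op} {σ τ : Ty} :
      HasType S Γ M (.arr σ τ) → HasType S Γ N σ → HasType S Γ (.app M N) τ
  | fix {Γ : List Ty} {M : Tm S.Op} {σ τ : Ty} :
      HasType S (.arr σ τ :: Γ) M (.arr σ τ) → HasType S Γ (.fix M) (.arr σ τ)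
  | pair {Γ : List Ty} {M N : Tm S.Op} {σ τ : Ty} :
      HasType S Γ M σ → HasType S Γ N τ → HasType S Γ (.pair M N) (.prod σ τ)
  | fst {Γ : List Ty} {M : Tm S.Op} {σ τ : Ty} :
      HasType S Γ M (.prod σ τ) → HasType S Γ (.fst M) σ
  | snd {Γ : List Ty} {M : Tm S.Op} {σ τ : Ty} :
      HasType S Γ M (.prod σ τ) → HasType S Γ (.snd M) τ
  | nil {Γ : List Ty} {σ : Ty} : HasType S Γ .nil (.list σ)
  | cons {Γ : List Ty} {H T : Tm S.Op} {σ : Ty} :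
      HasType S Γ H σ → HasType S Γ T (.list σ) → HasType S Γ (.cons H T) (.list σ)
  | caseList {Γ : List Ty} {L M N : Tm S.Op} {σ τ : Ty} :
      HasType S Γ L (.list σ) → HasType S Γ M τ → HasType S (σ :: .list σ :: Γ) N τ →
      HasType S Γ (.caseList L M N) τ

/-! ### Big-step semantics -/

/-- Values; pairs and lists are lazy. -/
inductive IsValue {Op : Type} : Tm Op → Prop
  | num (n : ℕ) : IsValue (.num n)
  | bool (b : Bool) : IsValue (.bool b)
  | nil : IsValue .nil
  | lam (M : Tm Op) : IsValue (.lam M)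
  | fix (M : Tm Op) : IsValue (.fix M)
  | cons (M N : Tm Op) : IsValue (.cons M N)
  | pair (M N : Tm Op) : IsValue (.pair M N)

/-- The point distribution on `V`. -/
noncomputable def dirac {Op : Type} (V : Tm Op) : Tm Op → ℝ≥0∞ :=
  open Classical in fun X => if X = V then 1 else 0

/-- `Eval S M D` is the approximation semantics `M ⇓ D`. Value distributions are functions on
terms that vanish outside the values. In the sums, terms outside the supports contribute `0`, so
that each sum ranges in effect over the supports. -/
inductive Eval (S : Signature) : Tm S.Op → (Tm S.Op → ℝ≥0∞) → Prop
  | empty (M : Tm S.Op) : Eval S M 0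
  | value {V : Tm S.Op} : IsValue V → Eval S V (dirac V)
  | op {M N : Tm S.Op} {D E : Tm S.Op → ℝ≥0∞} (o : S.Op) :
      Eval S M D → Eval S N E →
      Eval S (.op o M N)
        (fun X => ∑' n : ℕ, ∑' m : ℕ,
          D (.num n) * E (.num m) * dirac ((S.sem o).result n m) X)
  | app {M N : Tm S.Op} {K F : Tm S.Op → ℝ≥0∞} {E G : Tm S.Op → Tm S.Op → Tm S.Op → ℝ≥0∞} :
      Eval S M K → Eval S N F →
      (∀ P V, K (.lam P) ≠ 0 → F V ≠ 0 → Eval S (P.inst V) (E P V)) →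
      (∀ Q V, K (.fix Q) ≠ 0 → F V ≠ 0 → Eval S (.app (Q.inst (.fix Q)) V) (G Q V)) →
      Eval S (.app M N)
        (fun X => ∑' V, F V *
          ((∑' P, K (.lam P) * E P V X) + ∑' Q, K (.fix Q) * G Q V X))
  | ite {L M₁ M₂ : Tm S.Op} {D E₁ E₂ : Tm S.Op → ℝ≥0∞} :
      Eval S L D → Eval S M₁ E₁ → Eval S M₂ E₂ →
      Eval S (.ite L M₁ M₂) (fun X => D (.bool true) * E₁ X + D (.bool false) * E₂ X)
  | caseList {L M₁ M₂ : Tm S.Op} {D E : Tm S.Op → ℝ≥0∞}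
      {G K F : Tm S.Op → Tm S.Op → Tm S.Op → ℝ≥0∞} :
      Eval S L D → Eval S M₁ E →
      (∀ H T, D (.cons H T) ≠ 0 → Eval S H (G H T)) →
      (∀ H T, D (.cons H T) ≠ 0 → Eval S T (K H T)) →
      (∀ H T V W, D (.cons H T) ≠ 0 → G H T V ≠ 0 → K H T W ≠ 0 →
        Eval S (M₂.inst₂ V W) (F V W)) →
      Eval S (.caseList L M₁ M₂)
        (fun X => D .nil * E X +
          ∑' H, ∑' T, ∑' V, ∑' W, D (.cons H T) * G H T V * K H T W * F V W X)
  | fst {M : Tm S.Op} {D : Tm S.Op → ℝ≥0∞} {E : Tm S.Op → Tm S.Op → ℝ≥0∞} :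
      Eval S M D → (∀ P N, D (.pair P N) ≠ 0 → Eval S P (E P)) →
      Eval S (.fst M) (fun X => ∑' P, ∑' N, D (.pair P N) * E P X)
  | snd {M : Tm S.Op} {D : Tm S.Op → ℝ≥0∞} {E : Tm S.Op → Tm S.Op → ℝ≥0∞} :
      Eval S M D → (∀ P N, D (.pair P N) ≠ 0 → Eval S N (E N)) →
      Eval S (.snd M) (fun X => ∑' P, ∑' N, D (.pair P N) * E N X)
  | choice {M₁ M₂ : Tm S.Op} {D₁ D₂ : Tm S.Op → ℝ≥0∞} :
      Eval S M₁ D₁ → Eval S M₂ D₂ →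
      Eval S (.choice M₁ M₂) (fun X => 2⁻¹ * D₁ X + 2⁻¹ * D₂ X)

/-- The big-step semantics `⟦M⟧`: the pointwise supremum of all `D` with `M ⇓ D`. -/
noncomputable def denote (S : Signature) (M : Tm S.Op) : Tm S.Op → ℝ≥0∞ :=
  sSup {D | Eval S M D}

/-- The probability of convergence of `M`. -/
noncomputable def convProb (S : Signature) (M : Tm S.Op) : ℝ≥0∞ :=
  ∑' V, denote S M V


/-! ### `⟦M⟧` is a subdistribution -/

theorem tsum_dirac {Op : Type} (V : Tm Op) : ∑' X, dirac V X = 1 := by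
  classical
  unfold dirac
  exact tsum_ite_eq V _

theorem tsum_mix_le {α β : Type} {a : α → ℝ≥0∞} {b : α → β → ℝ≥0∞}
    (h : ∀ i, a i ≠ 0 → ∑' x, b i x ≤ 1) : ∑' x, ∑' i, a i * b i x ≤ ∑' i, a i := by
  rw [ENNReal.tsum_comm]
  refine ENNReal.tsum_le_tsum fun i => ?_
  rw [ENNReal.tsum_mul_left]
  by_cases hi : a i = 0
  · simp [hi]
  · exact mul_le_of_le_one_right' (h i hi)

theorem tsum_mix₂_le {α β γ : Type} {a : α → γ → ℝ≥0∞} {b : α → γ → β → ℝ≥0∞}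
    (h : ∀ i j, a i j ≠ 0 → ∑' x, b i j x ≤ 1) :
    ∑' x, ∑' i, ∑' j, a i j * b i j x ≤ ∑' i, ∑' j, a i j := by
  rw [ENNReal.tsum_comm]
  exact ENNReal.tsum_le_tsum fun i => tsum_mix_le (h i)

theorem tsum_inl_add_tsum_inr_le {α β γ : Type} {f : α → γ} {g : β → γ} {D : γ → ℝ≥0∞}
    (h : Function.Injective (Sum.elim f g)) (hD : ∑' x, D x ≤ 1) :
    (∑' a, D (f a)) + ∑' b, D (g b) ≤ 1 := by
  refine le_trans ?_ hD
  refine le_trans (le_of_eq ?_) (ENNReal.tsum_comp_le_tsum_of_injective h D)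
  exact (Summable.tsum_sum (f := fun s => D (Sum.elim f g s)) ENNReal.summable
    ENNReal.summable).symm

/-- Every distribution `D` with `M ⇓ D` has total mass at most one. -/
theorem Eval.tsum_le_one {S : Signature} {M : Tm S.Op} {D : Tm S.Op → ℝ≥0∞}
    (h : Eval S M D) : ∑' X, D X ≤ 1 := by
  induction h with
  | empty M => simp
  | value hV => exact (tsum_dirac _).le
  | @op M N D E o _ _ hD hE =>
    simp_rw [mul_assoc, ENNReal.tsum_mul_left]
    refine (tsum_mix_le fun n _ => ?_).trans ((ENNReal.tsum_comp_le_tsum_of_injective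
      (f := Tm.num) (fun a b h => by injection h) D).trans hD)
    refine (tsum_mix_le fun m _ => ?_).trans ((ENNReal.tsum_comp_le_tsum_of_injective
      (f := Tm.num) (fun a b h => by injection h) E).trans hE)
    exact (tsum_dirac _).le
  | @app M N K F E G _ _ _ _ hK hF hE hG =>
    refine (tsum_mix_le fun V hV => ?_).trans hF
    rw [ENNReal.tsum_add]
    refine (add_le_add (tsum_mix_le fun P hP => hE P V hP hV)
      (tsum_mix_le fun Q hQ => hG Q V hQ hV)).trans ?_
    refine tsum_inl_add_tsum_inr_le ?_ hK
    rintro (a | a) (b | b) h <;> simp_all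
  | @ite L M₁ M₂ D E₁ E₂ _ _ _ hD h₁ h₂ =>
    rw [ENNReal.tsum_add, ENNReal.tsum_mul_left, ENNReal.tsum_mul_left]
    refine (add_le_add (mul_le_of_le_one_right' h₁) (mul_le_of_le_one_right' h₂)).trans ?_
    refine le_trans (le_of_eq ?_) ((ENNReal.tsum_comp_le_tsum_of_injective
      (f := Tm.bool) (fun a b h => by injection h) D).trans hD)
    rw [tsum_fintype]; simp
  | @caseList L M₁ M₂ D E G K F _ _ _ _ _ hD hE hG hK hF =>
    simp_rw [mul_assoc, ENNReal.tsum_mul_left]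
    rw [ENNReal.tsum_add, ENNReal.tsum_mul_left]
    refine (add_le_add (mul_le_of_le_one_right' hE) (tsum_mix₂_le fun H T hHT => ?_)).trans ?_
    · refine (tsum_mix_le fun V hV => ?_).trans (hG H T hHT)
      refine (tsum_mix_le fun W hW => ?_).trans (hK H T hHT)
      exact hF H T V W hHT hV hW
    · have := tsum_inl_add_tsum_inr_le (f := fun _ : Unit => Tm.nil)
        (g := fun p : Tm S.Op × Tm S.Op => Tm.cons p.1 p.2) (D := D) ?_ hD
      · rw [ENNReal.tsum_prod (f := fun H T => D (Tm.cons H T))] at this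
        simpa using this
      · rintro (a | a) (b | b) h <;> simp_all [Prod.ext_iff]
  | @fst M D E _ _ hD hE =>
    refine (tsum_mix₂_le fun P N h => hE P N h).trans ?_
    rw [← ENNReal.tsum_prod (f := fun P N => D (Tm.pair P N))]
    refine (ENNReal.tsum_comp_le_tsum_of_injective
      (f := fun p : Tm S.Op × Tm S.Op => Tm.pair p.1 p.2) ?_ D).trans hD
    rintro a b h; simp_all [Prod.ext_iff]
  | @snd M D E _ _ hD hE =>
    refine (tsum_mix₂_le fun P N h => hE P N h).trans ?_
    rw [← ENNReal.tsum_prod (f := fun P N => D (Tm.pair P N))]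
    refine (ENNReal.tsum_comp_le_tsum_of_injective
      (f := fun p : Tm S.Op × Tm S.Op => Tm.pair p.1 p.2) ?_ D).trans hD
    rintro a b h; simp_all [Prod.ext_iff]
  | @choice M₁ M₂ D₁ D₂ _ _ h₁ h₂ =>
    rw [ENNReal.tsum_add, ENNReal.tsum_mul_left, ENNReal.tsum_mul_left]
    refine (add_le_add (mul_le_of_le_one_right' h₁) (mul_le_of_le_one_right' h₂)).trans ?_
    rw [ENNReal.inv_two_add_inv_two]

/-- Joining two families of derivable distributions, each given under a condition. -/
theorem Eval.join {S : Signature} {M : Tm S.Op} {p q : Prop} {D E : Tm S.Op → ℝ≥0∞}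
    (hD : p → Eval S M D) (hE : q → Eval S M E)
    (h : p → ∀ E', Eval S M E' → ∃ F, Eval S M F ∧ D ≤ F ∧ E' ≤ F) :
    ∃ F, Eval S M F ∧ (p → D ≤ F) ∧ (q → E ≤ F) := by
  by_cases hp : p
  · by_cases hq : q
    · obtain ⟨F, hF, h₁, h₂⟩ := h hp E (hE hq)
      exact ⟨F, hF, fun _ => h₁, fun _ => h₂⟩
    · exact ⟨D, hD hp, fun _ => le_rfl, fun h => absurd h hq⟩
  · by_cases hq : q
    · exact ⟨E, hE hq, fun h => absurd h hp, fun _ => le_rfl⟩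
    · exact ⟨0, .empty M, fun h => absurd h hp, fun h => absurd h hq⟩

theorem mul_mono_of_ne_zero {a b c d : ℝ≥0∞} (h₁ : a ≤ b) (h₂ : a ≠ 0 → c ≤ d) :
    a * c ≤ b * d := by
  by_cases ha : a = 0
  · simp [ha]
  · exact mul_le_mul' h₁ (h₂ ha)

theorem ne_zero_of_le {a b : ℝ≥0∞} (h : a ≤ b) (ha : a ≠ 0) : b ≠ 0 :=
  fun hb => ha (le_antisymm (hb ▸ h) zero_le)

/-- The distributions `D` with `M ⇓ D` form a directed set. -/
theorem Eval.directed {S : Signature} {M : Tm S.Op} {D E : Tm S.Op → ℝ≥0∞}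
    (hD : Eval S M D) (hE : Eval S M E) : ∃ F, Eval S M F ∧ D ≤ F ∧ E ≤ F := by
  induction hD generalizing E with
  | empty M => exact ⟨E, hE, fun _ => zero_le, le_rfl⟩
  | @value V hV =>
    refine ⟨dirac V, .value hV, le_rfl, ?_⟩
    cases hE <;> first | exact le_rfl | exact fun _ => zero_le | cases hV
  | @op M N D₁ D₂ o h₁ h₂ ih₁ ih₂ =>
    cases hE with
    | empty => exact ⟨_, .op o h₁ h₂, le_rfl, fun _ => zero_le⟩
    | value hV => cases hV
    | op _ h₁' h₂' =>
      obtain ⟨F₁, hF₁, a₁, b₁⟩ := ih₁ h₁'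
      obtain ⟨F₂, hF₂, a₂, b₂⟩ := ih₂ h₂'
      refine ⟨_, .op o hF₁ hF₂, fun X => ?_, fun X => ?_⟩
      · exact ENNReal.tsum_le_tsum fun n => ENNReal.tsum_le_tsum fun m =>
          mul_le_mul' (mul_le_mul' (a₁ _) (a₂ _)) le_rfl
      · exact ENNReal.tsum_le_tsum fun n => ENNReal.tsum_le_tsum fun m =>
          mul_le_mul' (mul_le_mul' (b₁ _) (b₂ _)) le_rfl
  | @app M N K F E₁ G₁ h₁ h₂ h₃ h₄ ih₁ ih₂ ih₃ ih₄ =>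
    cases hE with
    | empty => exact ⟨_, .app h₁ h₂ h₃ h₄, le_rfl, fun _ => zero_le⟩
    | value hV => cases hV
    | @app _ _ K' F' E₁' G₁' h₁' h₂' h₃' h₄' =>
      obtain ⟨K'', hK, a₁, b₁⟩ := ih₁ h₁'
      obtain ⟨F'', hF, a₂, b₂⟩ := ih₂ h₂'
      have hE := fun P V => Eval.join (p := K (.lam P) ≠ 0 ∧ F V ≠ 0)
        (q := K' (.lam P) ≠ 0 ∧ F' V ≠ 0) (fun h => h₃ P V h.1 h.2) (fun h => h₃' P V h.1 h.2)
        (fun h _ hE' => ih₃ P V h.1 h.2 hE')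
      have hG := fun Q V => Eval.join (p := K (.fix Q) ≠ 0 ∧ F V ≠ 0)
        (q := K' (.fix Q) ≠ 0 ∧ F' V ≠ 0) (fun h => h₄ Q V h.1 h.2) (fun h => h₄' Q V h.1 h.2)
        (fun h _ hE' => ih₄ Q V h.1 h.2 hE')
      choose E'' hE a₃ b₃ using hE
      choose G'' hG a₄ b₄ using hG
      refine ⟨_, .app hK hF (fun P V _ _ => hE P V) (fun Q V _ _ => hG Q V),
        fun X => ENNReal.tsum_le_tsum fun V => mul_mono_of_ne_zero (a₂ V) fun hV => ?_,
        fun X => ENNReal.tsum_le_tsum fun V => mul_mono_of_ne_zero (b₂ V) fun hV => ?_⟩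
      · exact add_le_add
          (ENNReal.tsum_le_tsum fun P => mul_mono_of_ne_zero (a₁ _) fun h => a₃ P V ⟨h, hV⟩ X)
          (ENNReal.tsum_le_tsum fun Q => mul_mono_of_ne_zero (a₁ _) fun h => a₄ Q V ⟨h, hV⟩ X)
      · exact add_le_add
          (ENNReal.tsum_le_tsum fun P => mul_mono_of_ne_zero (b₁ _) fun h => b₃ P V ⟨h, hV⟩ X)
          (ENNReal.tsum_le_tsum fun Q => mul_mono_of_ne_zero (b₁ _) fun h => b₄ Q V ⟨h, hV⟩ X)
  | @ite L M₁ M₂ D E₁ E₂ h₁ h₂ h₃ ih₁ ih₂ ih₃ =>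
    cases hE with
    | empty => exact ⟨_, .ite h₁ h₂ h₃, le_rfl, fun _ => zero_le⟩
    | value hV => cases hV
    | ite h₁' h₂' h₃' =>
      obtain ⟨F₁, hF₁, a₁, b₁⟩ := ih₁ h₁'
      obtain ⟨F₂, hF₂, a₂, b₂⟩ := ih₂ h₂'
      obtain ⟨F₃, hF₃, a₃, b₃⟩ := ih₃ h₃'
      exact ⟨_, .ite hF₁ hF₂ hF₃,
        fun X => add_le_add (mul_le_mul' (a₁ _) (a₂ X)) (mul_le_mul' (a₁ _) (a₃ X)),
        fun X => add_le_add (mul_le_mul' (b₁ _) (b₂ X)) (mul_le_mul' (b₁ _) (b₃ X))⟩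
  | @caseList L M₁ M₂ D E₁ G K F h₁ h₂ h₃ h₄ h₅ ih₁ ih₂ ih₃ ih₄ ih₅ =>
    cases hE with
    | empty => exact ⟨_, .caseList h₁ h₂ h₃ h₄ h₅, le_rfl, fun _ => zero_le⟩
    | value hV => cases hV
    | @caseList _ _ _ D' E₁' G' K' F' h₁' h₂' h₃' h₄' h₅' =>
      obtain ⟨D'', hD, a₁, b₁⟩ := ih₁ h₁'
      obtain ⟨E'', hE, a₂, b₂⟩ := ih₂ h₂'
      have hG := fun H T => Eval.join (h₃ H T) (h₃' H T) (fun h _ hE' => ih₃ H T h hE')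
      have hK := fun H T => Eval.join (h₄ H T) (h₄' H T) (fun h _ hE' => ih₄ H T h hE')
      choose G'' hG a₃ b₃ using hG
      choose K'' hK a₄ b₄ using hK
      have hF := fun V W => Eval.join (S := S) (M := M₂.inst₂ V W) (D := F V W) (E := F' V W)
        (p := ∃ H T, D (.cons H T) ≠ 0 ∧ G H T V ≠ 0 ∧ K H T W ≠ 0)
        (q := ∃ H T, D' (.cons H T) ≠ 0 ∧ G' H T V ≠ 0 ∧ K' H T W ≠ 0)
        (fun ⟨H, T, x, y, z⟩ => h₅ H T V W x y z) (fun ⟨H, T, x, y, z⟩ => h₅' H T V W x y z)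
        (fun ⟨H, T, x, y, z⟩ _ hE' => ih₅ H T V W x y z hE')
      choose F'' hF a₅ b₅ using hF
      refine ⟨_, .caseList hD hE (fun H T _ => hG H T) (fun H T _ => hK H T)
        (fun H T V W _ _ _ => hF V W),
        fun X => add_le_add (mul_le_mul' (a₁ _) (a₂ X)) (ENNReal.tsum_le_tsum fun H =>
          ENNReal.tsum_le_tsum fun T => ENNReal.tsum_le_tsum fun V =>
          ENNReal.tsum_le_tsum fun W => ?_),
        fun X => add_le_add (mul_le_mul' (b₁ _) (b₂ X)) (ENNReal.tsum_le_tsum fun H =>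
          ENNReal.tsum_le_tsum fun T => ENNReal.tsum_le_tsum fun V =>
          ENNReal.tsum_le_tsum fun W => ?_)⟩
      · refine mul_mono_of_ne_zero (mul_mono_of_ne_zero (mul_mono_of_ne_zero (a₁ _)
          fun h => a₃ H T h V) fun h => a₄ H T (left_ne_zero_of_mul h) W) fun h => ?_
        exact a₅ V W ⟨H, T, left_ne_zero_of_mul (left_ne_zero_of_mul h),
          right_ne_zero_of_mul (left_ne_zero_of_mul h), right_ne_zero_of_mul h⟩ X
      · refine mul_mono_of_ne_zero (mul_mono_of_ne_zero (mul_mono_of_ne_zero (b₁ _)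
          fun h => b₃ H T h V) fun h => b₄ H T (left_ne_zero_of_mul h) W) fun h => ?_
        exact b₅ V W ⟨H, T, left_ne_zero_of_mul (left_ne_zero_of_mul h),
          right_ne_zero_of_mul (left_ne_zero_of_mul h), right_ne_zero_of_mul h⟩ X
  | @fst M D E₁ h₁ h₂ ih₁ ih₂ =>
    cases hE with
    | empty => exact ⟨_, .fst h₁ h₂, le_rfl, fun _ => zero_le⟩
    | value hV => cases hV
    | @fst _ D' E₁' h₁' h₂' =>
      obtain ⟨D'', hD, a₁, b₁⟩ := ih₁ h₁'
      have hE := fun P => Eval.join (S := S) (M := P) (D := E₁ P) (E := E₁' P)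
        (p := ∃ N, D (.pair P N) ≠ 0) (q := ∃ N, D' (.pair P N) ≠ 0)
        (fun ⟨N, x⟩ => h₂ P N x) (fun ⟨N, x⟩ => h₂' P N x) (fun ⟨N, x⟩ _ hE' => ih₂ P N x hE')
      choose E'' hE a₂ b₂ using hE
      exact ⟨_, .fst hD (fun P _ _ => hE P),
        fun X => ENNReal.tsum_le_tsum fun P => ENNReal.tsum_le_tsum fun N =>
          mul_mono_of_ne_zero (a₁ _) fun h => a₂ P ⟨N, h⟩ X,
        fun X => ENNReal.tsum_le_tsum fun P => ENNReal.tsum_le_tsum fun N =>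
          mul_mono_of_ne_zero (b₁ _) fun h => b₂ P ⟨N, h⟩ X⟩
  | @snd M D E₁ h₁ h₂ ih₁ ih₂ =>
    cases hE with
    | empty => exact ⟨_, .snd h₁ h₂, le_rfl, fun _ => zero_le⟩
    | value hV => cases hV
    | @snd _ D' E₁' h₁' h₂' =>
      obtain ⟨D'', hD, a₁, b₁⟩ := ih₁ h₁'
      have hE := fun N => Eval.join (S := S) (M := N) (D := E₁ N) (E := E₁' N)
        (p := ∃ P, D (.pair P N) ≠ 0) (q := ∃ P, D' (.pair P N) ≠ 0)
        (fun ⟨P, x⟩ => h₂ P N x) (fun ⟨P, x⟩ => h₂' P N x) (fun ⟨P, x⟩ _ hE' => ih₂ P N x hE')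
      choose E'' hE a₂ b₂ using hE
      exact ⟨_, .snd hD (fun _ N _ => hE N),
        fun X => ENNReal.tsum_le_tsum fun P => ENNReal.tsum_le_tsum fun N =>
          mul_mono_of_ne_zero (a₁ _) fun h => a₂ N ⟨P, h⟩ X,
        fun X => ENNReal.tsum_le_tsum fun P => ENNReal.tsum_le_tsum fun N =>
          mul_mono_of_ne_zero (b₁ _) fun h => b₂ N ⟨P, h⟩ X⟩
  | choice h₁ h₂ ih₁ ih₂ =>
    cases hE with
    | empty => exact ⟨_, .choice h₁ h₂, le_rfl, fun _ => zero_le⟩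
    | value hV => cases hV
    | choice h₁' h₂' =>
      obtain ⟨F₁, hF₁, a₁, b₁⟩ := ih₁ h₁'
      obtain ⟨F₂, hF₂, a₂, b₂⟩ := ih₂ h₂'
      exact ⟨_, .choice hF₁ hF₂,
        fun X => add_le_add (mul_le_mul' le_rfl (a₁ X)) (mul_le_mul' le_rfl (a₂ X)),
        fun X => add_le_add (mul_le_mul' le_rfl (b₁ X)) (mul_le_mul' le_rfl (b₂ X))⟩

theorem tsum_denote_le_one (S : Signature) (M : Tm S.Op) : ∑' V, denote S M V ≤ 1 := by
  rw [ENNReal.tsum_eq_iSup_sum]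
  refine iSup_le fun s => ?_
  simp only [denote, sSup_apply]
  rw [ENNReal.finsetSum_iSup]
  · exact iSup_le fun D => (ENNReal.sum_le_tsum s).trans D.2.tsum_le_one
  · rintro ⟨D, hD⟩ ⟨E, hE⟩
    obtain ⟨F, hF, h₁, h₂⟩ := hD.directed hE
    exact ⟨⟨F, hF⟩, fun X => ⟨h₁ X, h₂ X⟩⟩

/-! ### Labelled Markov chains, simulation and bisimulation -/

/-- Labelled Markov chains: countably many states and a transition probability matrix, each row of
which sums to at most one. -/
structure LMC where
  State : Type
  Label : Type
  P : State → Label → State → ℝ≥0∞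
  countable : Countable State
  tsum_le_one : ∀ s l, ∑' t, P s l t ≤ 1

/-- The probability `P(s, l, X)` of moving from `s` into the set `X` under the label `l`. -/
noncomputable def LMC.prob (C : LMC) (s : C.State) (l : C.Label) (X : Set C.State) : ℝ≥0∞ :=
  ∑' t : X, C.P s l t

/-- Probabilistic simulations: preorders `R` such that `s R t` implies
`P(s, l, X) ≤ P(t, l, R(X))` for all `l` and `X`. -/
structure LMC.IsSimulation (C : LMC) (R : C.State → C.State → Prop) : Prop where
  refl : ∀ s, R s s
  trans : ∀ s t u, R s t → R t u → R s u
  sim : ∀ s t, R s t → ∀ (l : C.Label) (X : Set C.State),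
    C.prob s l X ≤ C.prob t l {y | ∃ x ∈ X, R x y}

/-- Probabilistic bisimulations: equivalence relations `R` such that `s R t` implies
`P(s, l, E) = P(t, l, E)` for all `l` and all equivalence classes `E` modulo `R`. -/
structure LMC.IsBisimulation (C : LMC) (R : C.State → C.State → Prop) : Prop where
  equiv : Equivalence R
  bisim : ∀ s t, R s t → ∀ (l : C.Label) (u : C.State),
    C.prob s l {y | R u y} = C.prob t l {y | R u y}

/-- Similarity: the union of all probabilistic simulations. -/
def LMC.Similar (C : LMC) (s t : C.State) : Prop :=
  ∃ R, C.IsSimulation R ∧ R s t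

/-- Bisimilarity: the union of all probabilistic bisimulations. -/
def LMC.Bisimilar (C : LMC) (s t : C.State) : Prop :=
  ∃ R, C.IsBisimulation R ∧ R s t

/-! ### The labelled Markov chain of programs -/

/-- The states `(M, σ)` with `M` a closed term of type `σ`. -/
abbrev TermState (S : Signature) : Type :=
  {p : Tm S.Op × Ty // HasType S [] p.1 p.2}

/-- The states `(V̂, σ)` with `V` a closed value of type `σ`. -/
abbrev ValueState (S : Signature) : Type :=
  {p : Tm S.Op × Ty // IsValue p.1 ∧ HasType S [] p.1 p.2}

/-- The states: the disjoint union of terms and distinguished values. -/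
abbrev State (S : Signature) : Type := TermState S ⊕ ValueState S

/-- The labels: values, types, natural numbers, booleans, `nil`, `hd`, `tl`, `fst`, `snd` and
`eval`. -/
inductive Label (S : Signature) : Type
  | val : {V : Tm S.Op // IsValue V} → Label S
  | ty : Ty → Label S
  | num : ℕ → Label S
  | bool : Bool → Label S
  | nil : Label S
  | hd : Label S
  | tl : Label S
  | fst : Label S
  | snd : Label S
  | eval : Label S

/-- The transitions that have probability one, other than those labelled `eval`. -/
inductive DetStep (S : Signature) : State S → Label S → State S → Prop
  | tyTerm {M : Tm S.Op} {σ : Ty} (h : HasType S [] M σ) :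
      DetStep S (.inl ⟨(M, σ), h⟩) (.ty σ) (.inl ⟨(M, σ), h⟩)
  | tyValue {V : Tm S.Op} {σ : Ty} (h : IsValue V ∧ HasType S [] V σ) :
      DetStep S (.inr ⟨(V, σ), h⟩) (.ty σ) (.inr ⟨(V, σ), h⟩)
  | lam {M W : Tm S.Op} {τ θ : Ty}
      (h : IsValue (.lam M) ∧ HasType S [] (.lam M) (.arr τ θ))
      (hW : IsValue W) (_ : HasType S [] W τ) (h' : HasType S [] (M.inst W) θ) :
      DetStep S (.inr ⟨(.lam M, .arr τ θ), h⟩) (.val ⟨W, hW⟩) (.inl ⟨(M.inst W, θ), h'⟩)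
  | fix {M W : Tm S.Op} {τ θ : Ty}
      (h : IsValue (.fix M) ∧ HasType S [] (.fix M) (.arr τ θ))
      (hW : IsValue W) (_ : HasType S [] W τ)
      (h' : HasType S [] (.app (M.inst (.fix M)) W) θ) :
      DetStep S (.inr ⟨(.fix M, .arr τ θ), h⟩) (.val ⟨W, hW⟩)
        (.inl ⟨(.app (M.inst (.fix M)) W, θ), h'⟩)
  | fst {M N : Tm S.Op} {τ θ : Ty}
      (h : IsValue (.pair M N) ∧ HasType S [] (.pair M N) (.prod τ θ)) (h' : HasType S [] M τ) :
      DetStep S (.inr ⟨(.pair M N, .prod τ θ), h⟩) .fst (.inl ⟨(M, τ), h'⟩)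
  | snd {M N : Tm S.Op} {τ θ : Ty}
      (h : IsValue (.pair M N) ∧ HasType S [] (.pair M N) (.prod τ θ)) (h' : HasType S [] N θ) :
      DetStep S (.inr ⟨(.pair M N, .prod τ θ), h⟩) .snd (.inl ⟨(N, θ), h'⟩)
  | num {k : ℕ} (h : IsValue (.num k) ∧ HasType S [] (.num k) .int) :
      DetStep S (.inr ⟨(.num k, .int), h⟩) (.num k) (.inr ⟨(.num k, .int), h⟩)
  | bool {b : Bool} (h : IsValue (.bool b) ∧ HasType S [] (.bool b) .bool) :
      DetStep S (.inr ⟨(.bool b, .bool), h⟩) (.bool b) (.inr ⟨(.bool b, .bool), h⟩)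
  | nil {τ : Ty} (h : IsValue .nil ∧ HasType S [] .nil (.list τ)) :
      DetStep S (.inr ⟨(.nil, .list τ), h⟩) .nil (.inr ⟨(.nil, .list τ), h⟩)
  | hd {M N : Tm S.Op} {τ : Ty}
      (h : IsValue (.cons M N) ∧ HasType S [] (.cons M N) (.list τ)) (h' : HasType S [] M τ) :
      DetStep S (.inr ⟨(.cons M N, .list τ), h⟩) .hd (.inl ⟨(M, τ), h'⟩)
  | tl {M N : Tm S.Op} {τ : Ty}
      (h : IsValue (.cons M N) ∧ HasType S [] (.cons M N) (.list τ))
      (h' : HasType S [] N (.list τ)) :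
      DetStep S (.inr ⟨(.cons M N, .list τ), h⟩) .tl (.inl ⟨(N, .list τ), h'⟩)

/-- The transition probability matrix. Under `eval` the state `(M, σ)` moves to `(V̂, σ)` with
probability `⟦M⟧(V)`. -/
noncomputable def transProb (S : Signature) : State S → Label S → State S → ℝ≥0∞ :=
  open Classical in fun s l t =>
    match s, l, t with
    | .inl M, .eval, .inr V => if V.1.2 = M.1.2 then denote S M.1.1 V.1.1 else 0
    | s, l, t => if DetStep S s l t then 1 else 0

theorem DetStep.unique {S : Signature} {s t u : State S} {l : Label S}
    (h : DetStep S s l t) (h' : DetStep S s l u) : t = u := by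
  cases h <;> cases h' <;> rfl

theorem tsum_transProb_le_one (S : Signature) (s : State S) (l : Label S) :
    ∑' t, transProb S s l t ≤ 1 := by
  classical
  by_cases hs : l = .eval ∧ ∃ M, s = .inl M
  · obtain ⟨rfl, ⟨⟨M, σ⟩, hM⟩, rfl⟩ := hs
    have h₁ : ∀ t : TermState S, transProb S (.inl ⟨(M, σ), hM⟩) .eval (.inl t) = 0 := by
      intro t
      simp only [transProb]
      rw [if_neg (fun h => by cases h)]
    rw [Summable.tsum_sum ENNReal.summable ENNReal.summable]
    simp only [h₁, tsum_zero, zero_add]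
    have h₂ : ∀ t : ValueState S, transProb S (.inl ⟨(M, σ), hM⟩) .eval (.inr t) =
        ({t : ValueState S | t.1.2 = σ}).indicator (fun t => denote S M t.1.1) t := by
      intro t
      simp [transProb, Set.indicator]
    rw [tsum_congr h₂, ← tsum_subtype]
    refine le_trans (ENNReal.tsum_comp_le_tsum_of_injective
      (f := fun t : {t : ValueState S | t.1.2 = σ} => t.1.1.1) ?_ (denote S M))
      (tsum_denote_le_one S M)
    rintro ⟨⟨⟨V, _⟩, _⟩, hV⟩ ⟨⟨⟨W, _⟩, _⟩, hW⟩ h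
    simp only [Set.mem_ofPred_eq] at hV hW h
    subst hV; subst hW; subst h; rfl
  · have h₁ : ∀ t, transProb S s l t = if DetStep S s l t then 1 else 0 := by
      intro t
      rcases s with s | s <;> rcases t with t | t <;> cases l <;> simp_all [transProb]
    simp_rw [h₁]
    by_cases h : ∃ t, DetStep S s l t
    · obtain ⟨t, ht⟩ := h
      have : ∀ u, (if DetStep S s l u then (1 : ℝ≥0∞) else 0) = if u = t then 1 else 0 := by
        intro u
        congr 1
        exact propext ⟨fun h => h.unique ht, fun h => h ▸ ht⟩
      rw [tsum_congr this, tsum_ite_eq]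
    · push Not at h
      simp [h]

/-- The labelled Markov chain of programs. -/
noncomputable abbrev chain (S : Signature) : LMC where
  State := State S
  Label := Label S
  P := transProb S
  countable := have := S.finite; inferInstance
  tsum_le_one := tsum_transProb_le_one S

/-! ### Typed relations -/

/-- Typed relations: families of binary relations on the terms of type `σ` under `Γ`. -/
structure TypedRel (S : Signature) where
  rel : List Ty → Ty → Tm S.Op → Tm S.Op → Prop
  left_typed : ∀ {Γ σ M N}, rel Γ σ M N → HasType S Γ M σ
  right_typed : ∀ {Γ σ M N}, rel Γ σ M N → HasType S Γ N σ

/-- Inclusion of typed relations. -/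
def TypedRel.Included {S : Signature} (R Q : TypedRel S) : Prop :=
  ∀ Γ σ M N, R.rel Γ σ M N → Q.rel Γ σ M N

def TypedRel.IsSymmetric {S : Signature} (R : TypedRel S) : Prop :=
  ∀ Γ σ M N, R.rel Γ σ M N → R.rel Γ σ N M

def TypedRel.IsTransitive {S : Signature} (R : TypedRel S) : Prop :=
  ∀ Γ σ M N L, R.rel Γ σ M N → R.rel Γ σ N L → R.rel Γ σ M L

/-- Compatibility: closure under every construct of the language. -/
structure TypedRel.IsCompatible {S : Signature} (R : TypedRel S) : Prop where
  var : ∀ (Γ : List Ty) (i : ℕ) (σ : Ty), Γ[i]? = some σ → R.rel Γ σ (.var i) (.var i)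
  num : ∀ (Γ : List Ty) (k : ℕ), R.rel Γ .int (.num k) (.num k)
  bool : ∀ (Γ : List Ty) (b : Bool), R.rel Γ .bool (.bool b) (.bool b)
  nil : ∀ (Γ : List Ty) (σ : Ty), R.rel Γ (.list σ) .nil .nil
  pair : ∀ (Γ : List Ty) (σ τ : Ty) (M M' N N' : Tm S.Op),
    R.rel Γ σ M M' → R.rel Γ τ N N' → R.rel Γ (.prod σ τ) (.pair M N) (.pair M' N')
  cons : ∀ (Γ : List Ty) (σ : Ty) (M M' N N' : Tm S.Op),
    R.rel Γ σ M M' → R.rel Γ (.list σ) N N' → R.rel Γ (.list σ) (.cons M N) (.cons M' N')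
  lam : ∀ (Γ : List Ty) (σ τ : Ty) (M M' : Tm S.Op),
    R.rel (σ :: Γ) τ M M' → R.rel Γ (.arr σ τ) (.lam M) (.lam M')
  fix : ∀ (Γ : List Ty) (σ τ : Ty) (M M' : Tm S.Op),
    R.rel (.arr σ τ :: Γ) (.arr σ τ) M M' → R.rel Γ (.arr σ τ) (.fix M) (.fix M')
  choice : ∀ (Γ : List Ty) (σ : Ty) (M M' N N' : Tm S.Op),
    R.rel Γ σ M M' → R.rel Γ σ N N' → R.rel Γ σ (.choice M N) (.choice M' N')
  ite : ∀ (Γ : List Ty) (σ : Ty) (L L' M M' N N' : Tm S.Op),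
    R.rel Γ .bool L L' → R.rel Γ σ M M' → R.rel Γ σ N N' →
    R.rel Γ σ (.ite L M N) (.ite L' M' N')
  op : ∀ (Γ : List Ty) (o : S.Op) (M M' N N' : Tm S.Op),
    R.rel Γ .int M M' → R.rel Γ .int N N' →
    R.rel Γ (S.sem o).resTy (.op o M N) (.op o M' N')
  fst : ∀ (Γ : List Ty) (σ τ : Ty) (M M' : Tm S.Op),
    R.rel Γ (.prod σ τ) M M' → R.rel Γ σ (.fst M) (.fst M')
  snd : ∀ (Γ : List Ty) (σ τ : Ty) (M M' : Tm S.Op),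
    R.rel Γ (.prod σ τ) M M' → R.rel Γ τ (.snd M) (.snd M')
  caseList : ∀ (Γ : List Ty) (σ τ : Ty) (L L' M M' N N' : Tm S.Op),
    R.rel Γ (.list σ) L L' → R.rel Γ τ M M' → R.rel (σ :: .list σ :: Γ) τ N N' →
    R.rel Γ τ (.caseList L M N) (.caseList L' M' N')
  app : ∀ (Γ : List Ty) (σ τ : Ty) (M M' N N' : Tm S.Op),
    R.rel Γ (.arr σ τ) M M' → R.rel Γ σ N N' → R.rel Γ τ (.app M N) (.app M' N')

/-- Precongruences: transitive and compatible typed relations. -/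
def TypedRel.IsPrecongruence {S : Signature} (R : TypedRel S) : Prop :=
  R.IsTransitive ∧ R.IsCompatible

/-- Congruences: symmetric, transitive and compatible typed relations. -/
def TypedRel.IsCongruence {S : Signature} (R : TypedRel S) : Prop :=
  R.IsSymmetric ∧ R.IsTransitive ∧ R.IsCompatible

/-! ### Contexts, contextual preorder and context equivalence -/

/-- Contexts: syntax trees with a unique hole. -/
inductive Ctx (Op : Type) : Type
  | hole : Ctx Op
  | lam : Ctx Op → Ctx Op
  | fix : Ctx Op → Ctx Op
  | appL : Ctx Op → Tm Op → Ctx Op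
  | appR : Tm Op → Ctx Op → Ctx Op
  | choiceL : Ctx Op → Tm Op → Ctx Op
  | choiceR : Tm Op → Ctx Op → Ctx Op
  | opL : Op → Ctx Op → Tm Op → Ctx Op
  | opR : Op → Tm Op → Ctx Op → Ctx Op
  | pairL : Ctx Op → Tm Op → Ctx Op
  | pairR : Tm Op → Ctx Op → Ctx Op
  | fst : Ctx Op → Ctx Op
  | snd : Ctx Op → Ctx Op
  | iteC : Ctx Op → Tm Op → Tm Op → Ctx Op
  | iteT : Tm Op → Ctx Op → Tm Op → Ctx Op
  | iteE : Tm Op → Tm Op → Ctx Op → Ctx Op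
  | consL : Ctx Op → Tm Op → Ctx Op
  | consR : Tm Op → Ctx Op → Ctx Op
  | caseL : Ctx Op → Tm Op → Tm Op → Ctx Op
  | caseN : Tm Op → Ctx Op → Tm Op → Ctx Op
  | caseC : Tm Op → Tm Op → Ctx Op → Ctx Op

/-- `C[M]`: the hole is replaced by `M`, whose free variables may get captured. -/
def Ctx.plug {Op : Type} : Ctx Op → Tm Op → Tm Op
  | .hole, X => X
  | .lam C, X => .lam (C.plug X)
  | .fix C, X => .fix (C.plug X)
  | .appL C M, X => .app (C.plug X) M
  | .appR M C, X => .app M (C.plug X)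
  | .choiceL C M, X => .choice (C.plug X) M
  | .choiceR M C, X => .choice M (C.plug X)
  | .opL o C M, X => .op o (C.plug X) M
  | .opR o M C, X => .op o M (C.plug X)
  | .pairL C M, X => .pair (C.plug X) M
  | .pairR M C, X => .pair M (C.plug X)
  | .fst C, X => .fst (C.plug X)
  | .snd C, X => .snd (C.plug X)
  | .iteC C M N, X => .ite (C.plug X) M N
  | .iteT L C N, X => .ite L (C.plug X) N
  | .iteE L M C, X => .ite L M (C.plug X)
  | .consL C M, X => .cons (C.plug X) M
  | .consR M C, X => .cons M (C.plug X)
  | .caseL C M N, X => .caseList (C.plug X) M N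
  | .caseN L C N, X => .caseList L (C.plug X) N
  | .caseC L M C, X => .caseList L M (C.plug X)

/-- `CtxType S Γ C Δ B τ`: if the hole of `C` is filled by a term of type `B` under the typing
context `Δ`, then the result has type `τ` under `Γ`. Here `Δ` lists all variables visible at the
hole; so if `Γ` is empty then `Δ` lists exactly those bound by `C` above the hole. -/
inductive CtxType (S : Signature) : List Ty → Ctx S.Op → List Ty → Ty → Ty → Prop
  | hole {Γ : List Ty} {B : Ty} : CtxType S Γ .hole Γ B B
  | lam {Γ Δ : List Ty} {C : Ctx S.Op} {B σ τ : Ty} :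
      CtxType S (σ :: Γ) C Δ B τ → CtxType S Γ (.lam C) Δ B (.arr σ τ)
  | fix {Γ Δ : List Ty} {C : Ctx S.Op} {B σ τ : Ty} :
      CtxType S (.arr σ τ :: Γ) C Δ B (.arr σ τ) → CtxType S Γ (.fix C) Δ B (.arr σ τ)
  | appL {Γ Δ : List Ty} {C : Ctx S.Op} {M : Tm S.Op} {B σ τ : Ty} :
      CtxType S Γ C Δ B (.arr σ τ) → HasType S Γ M σ → CtxType S Γ (.appL C M) Δ B τ
  | appR {Γ Δ : List Ty} {C : Ctx S.Op} {M : Tm S.Op} {B σ τ : Ty} :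
      HasType S Γ M (.arr σ τ) → CtxType S Γ C Δ B σ → CtxType S Γ (.appR M C) Δ B τ
  | choiceL {Γ Δ : List Ty} {C : Ctx S.Op} {M : Tm S.Op} {B σ : Ty} :
      CtxType S Γ C Δ B σ → HasType S Γ M σ → CtxType S Γ (.choiceL C M) Δ B σ
  | choiceR {Γ Δ : List Ty} {C : Ctx S.Op} {M : Tm S.Op} {B σ : Ty} :
      HasType S Γ M σ → CtxType S Γ C Δ B σ → CtxType S Γ (.choiceR M C) Δ B σ
  | opL {Γ Δ : List Ty} {C : Ctx S.Op} {M : Tm S.Op} {B : Ty} (o : S.Op) :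
      CtxType S Γ C Δ B .int → HasType S Γ M .int →
      CtxType S Γ (.opL o C M) Δ B (S.sem o).resTy
  | opR {Γ Δ : List Ty} {C : Ctx S.Op} {M : Tm S.Op} {B : Ty} (o : S.Op) :
      HasType S Γ M .int → CtxType S Γ C Δ B .int →
      CtxType S Γ (.opR o M C) Δ B (S.sem o).resTy
  | pairL {Γ Δ : List Ty} {C : Ctx S.Op} {M : Tm S.Op} {B σ τ : Ty} :
      CtxType S Γ C Δ B σ → HasType S Γ M τ → CtxType S Γ (.pairL C M) Δ B (.prod σ τ)
  | pairR {Γ Δ : List Ty} {C : Ctx S.Op} {M : Tm S.Op} {B σ τ : Ty} :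
      HasType S Γ M σ → CtxType S Γ C Δ B τ → CtxType S Γ (.pairR M C) Δ B (.prod σ τ)
  | fst {Γ Δ : List Ty} {C : Ctx S.Op} {B σ τ : Ty} :
      CtxType S Γ C Δ B (.prod σ τ) → CtxType S Γ (.fst C) Δ B σ
  | snd {Γ Δ : List Ty} {C : Ctx S.Op} {B σ τ : Ty} :
      CtxType S Γ C Δ B (.prod σ τ) → CtxType S Γ (.snd C) Δ B τ
  | iteC {Γ Δ : List Ty} {C : Ctx S.Op} {M N : Tm S.Op} {B σ : Ty} :
      CtxType S Γ C Δ B .bool → HasType S Γ M σ → HasType S Γ N σ →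
      CtxType S Γ (.iteC C M N) Δ B σ
  | iteT {Γ Δ : List Ty} {C : Ctx S.Op} {L N : Tm S.Op} {B σ : Ty} :
      HasType S Γ L .bool → CtxType S Γ C Δ B σ → HasType S Γ N σ →
      CtxType S Γ (.iteT L C N) Δ B σ
  | iteE {Γ Δ : List Ty} {C : Ctx S.Op} {L M : Tm S.Op} {B σ : Ty} :
      HasType S Γ L .bool → HasType S Γ M σ → CtxType S Γ C Δ B σ →
      CtxType S Γ (.iteE L M C) Δ B σ
  | consL {Γ Δ : List Ty} {C : Ctx S.Op} {M : Tm S.Op} {B σ : Ty} :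
      CtxType S Γ C Δ B σ → HasType S Γ M (.list σ) → CtxType S Γ (.consL C M) Δ B (.list σ)
  | consR {Γ Δ : List Ty} {C : Ctx S.Op} {M : Tm S.Op} {B σ : Ty} :
      HasType S Γ M σ → CtxType S Γ C Δ B (.list σ) → CtxType S Γ (.consR M C) Δ B (.list σ)
  | caseL {Γ Δ : List Ty} {C : Ctx S.Op} {M N : Tm S.Op} {B σ τ : Ty} :
      CtxType S Γ C Δ B (.list σ) → HasType S Γ M τ → HasType S (σ :: .list σ :: Γ) N τ →
      CtxType S Γ (.caseL C M N) Δ B τ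
  | caseN {Γ Δ : List Ty} {C : Ctx S.Op} {L N : Tm S.Op} {B σ τ : Ty} :
      HasType S Γ L (.list σ) → CtxType S Γ C Δ B τ → HasType S (σ :: .list σ :: Γ) N τ →
      CtxType S Γ (.caseN L C N) Δ B τ
  | caseC {Γ Δ : List Ty} {C : Ctx S.Op} {L M : Tm S.Op} {B σ τ : Ty} :
      HasType S Γ L (.list σ) → HasType S Γ M τ → CtxType S (σ :: .list σ :: Γ) C Δ B τ →
      CtxType S Γ (.caseC L M C) Δ B τ

/-- The contextual preorder: for every closing context, of whatever result type, the probability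
of convergence does not decrease. -/
def ctxPreorder (S : Signature) : TypedRel S where
  rel Γ τ M N := HasType S Γ M τ ∧ HasType S Γ N τ ∧
    ∀ (C : Ctx S.Op) (σ : Ty), CtxType S [] C Γ τ σ →
      convProb S (C.plug M) ≤ convProb S (C.plug N)
  left_typed h := h.1
  right_typed h := h.2.1

/-- Context equivalence. -/
def ctxEquiv (S : Signature) : TypedRel S where
  rel Γ τ M N := (ctxPreorder S).rel Γ τ M N ∧ (ctxPreorder S).rel Γ τ N M
  left_typed h := h.1.1
  right_typed h := h.1.2.1

/-! ### Applicative similarity and bisimilarity -/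

/-- Similarity of the closed terms `M`, `N` of type `σ`. -/
def ClosedSim (S : Signature) (σ : Ty) (M N : Tm S.Op) : Prop :=
  ∃ (hM : HasType S [] M σ) (hN : HasType S [] N σ),
    (chain S).Similar (.inl ⟨(M, σ), hM⟩) (.inl ⟨(N, σ), hN⟩)

/-- Bisimilarity of the closed terms `M`, `N` of type `σ`. -/
def ClosedBisim (S : Signature) (σ : Ty) (M N : Tm S.Op) : Prop :=
  ∃ (hM : HasType S [] M σ) (hN : HasType S [] N σ),
    (chain S).Bisimilar (.inl ⟨(M, σ), hM⟩) (.inl ⟨(N, σ), hN⟩)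

/-- `Γ`-closures: each variable of `Γ` is sent to a closed value of its type (what happens to
other variables is irrelevant for terms typed under `Γ`). -/
def IsClosure (S : Signature) (Γ : List Ty) (ξ : ℕ → Tm S.Op) : Prop :=
  ∀ (i : ℕ) (τ : Ty), Γ[i]? = some τ → IsValue (ξ i) ∧ HasType S [] (ξ i) τ

/-- The open extension of a type-indexed family of relations on closed terms. -/
def openExt (S : Signature) (R : Ty → Tm S.Op → Tm S.Op → Prop) : TypedRel S where
  rel Γ σ M N := HasType S Γ M σ ∧ HasType S Γ N σ ∧
    ∀ ξ : ℕ → Tm S.Op, IsClosure S Γ ξ → R σ (M.subst ξ) (N.subst ξ)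
  left_typed h := h.1
  right_typed h := h.2.1

/-- The simulation preorder. -/
def simPreorder (S : Signature) : TypedRel S := openExt S (ClosedSim S)

/-- Bisimulation equivalence. -/
def bisimEquiv (S : Signature) : TypedRel S := openExt S (ClosedBisim S)

end PCFL

open scoped ENNReal

namespace PCFL

/-! ### Renaming and substitution -/

section Substitution

variable {Op : Type}

/-! The proof is Howe's method, carried out on expectations. Compatibility of similarity cannot be
attacked directly: comparing two applications forces the substitution of different, merely similar,
arguments. Howe's lifting `Howe` is compatible and substitutive by construction
(`howeRel_isCompatible`, `Howe.subst`), contains similarity, and absorbs similarity on the right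
(`Howe.trans_sim`). It remains to see that it is contained in similarity; then the two coincide and
compatibility is inherited.

For this, the reflexive transitive closure of Howe's lifting on the states of the chain is shown to
be a simulation. Deterministic transitions are matched by inverting the lifting on values. The
`eval` transitions need the key lemma `Howe.dominated`: if `f V ≤ g W` for all related values `V`,
`W`, then related programs satisfy the same inequality between the expectation of `f` on the left
and of `g` on the right. Indicator functions then give the simulation condition, and the constant
`1` compares probabilities of convergence, whence inclusion in the contextual preorder.

The key lemma is an induction along the Kleene iterates `approx` of the one-step unfolding
`stepDist`, whose supremum is the semantics (`denote_eq_iSup_approx`). For every construct the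
expectation over the result is a nested expectation over the subcomputations, so the induction
hypothesis applies layer by layer, each inner layer serving as test function for the next outer one.
The similarity step that ends every rule of the lifting is absorbed by `Dominated.trans_sim`,
because similarity itself compares expectations (`ClosedSim.tsum_le`): the condition on sets
integrates to one on functions by the layer cake formula. No couplings or flow arguments are needed.

Bisimulation reduces to simulation: since all masses are finite, bisimilarity is mutual similarity
(`LMC.bisimilar_iff`), and the second half of the theorem is the symmetrisation of the first. -/

theorem liftRen_comp (ρ ρ' : ℕ → ℕ) : liftRen ρ' ∘ liftRen ρ = liftRen (ρ' ∘ ρ) := by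
  funext i; cases i <;> rfl

theorem liftSub_comp_liftRen (θ : ℕ → Tm Op) (ρ : ℕ → ℕ) :
    liftSub θ ∘ liftRen ρ = liftSub (θ ∘ ρ) := by
  funext i; cases i <;> rfl

theorem liftSub_var : liftSub (Tm.var : ℕ → Tm Op) = Tm.var := by
  funext i; cases i <;> rfl

theorem Tm.rename_rename (M : Tm Op) (ρ ρ' : ℕ → ℕ) :
    (M.rename ρ).rename ρ' = M.rename (ρ' ∘ ρ) := by
  induction M generalizing ρ ρ' <;> simp_all [Tm.rename, liftRen_comp]

theorem Tm.subst_rename (M : Tm Op) (ρ : ℕ → ℕ) (θ : ℕ → Tm Op) :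
    (M.rename ρ).subst θ = M.subst (θ ∘ ρ) := by
  induction M generalizing ρ θ <;> simp_all [Tm.rename, Tm.subst, liftSub_comp_liftRen]

theorem rename_comp_liftSub (θ : ℕ → Tm Op) (ρ : ℕ → ℕ) :
    Tm.rename (liftRen ρ) ∘ liftSub θ = liftSub (Tm.rename ρ ∘ θ) := by
  funext i
  cases i with
  | zero => rfl
  | succ i => simp only [Function.comp, liftSub, Tm.rename_rename]; rfl

theorem Tm.rename_subst (M : Tm Op) (θ : ℕ → Tm Op) (ρ : ℕ → ℕ) :
    (M.subst θ).rename ρ = M.subst (Tm.rename ρ ∘ θ) := by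
  induction M generalizing ρ θ <;> simp_all [Tm.rename, Tm.subst, rename_comp_liftSub]

/-- Crossing a binder renames the substituted terms, so composing substitutions rests on the
exchange of substitution with renaming in both orders. -/
theorem subst_comp_liftSub (θ ξ : ℕ → Tm Op) :
    Tm.subst (liftSub ξ) ∘ liftSub θ = liftSub (Tm.subst ξ ∘ θ) := by
  funext i
  cases i with
  | zero => rfl
  | succ i => simp only [Function.comp, liftSub, Tm.subst_rename, Tm.rename_subst]; rfl

theorem Tm.subst_subst (M : Tm Op) (θ ξ : ℕ → Tm Op) :
    (M.subst θ).subst ξ = M.subst (Tm.subst ξ ∘ θ) := by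
  induction M generalizing ξ θ <;> simp_all [Tm.subst, subst_comp_liftSub]

/-- The substitution of `M.inst V`. -/
def instSub (V : Tm Op) : ℕ → Tm Op
  | 0 => V
  | n + 1 => .var n

/-- The substitution of `M.inst₂ V W`. -/
def instSub₂ (V W : Tm Op) : ℕ → Tm Op
  | 0 => V
  | 1 => W
  | n + 2 => .var n

theorem Tm.inst_eq_subst (M V : Tm Op) : M.inst V = M.subst (instSub V) := by
  unfold Tm.inst
  congr 1

theorem Tm.inst₂_eq_subst (M V W : Tm Op) : M.inst₂ V W = M.subst (instSub₂ V W) := by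
  unfold Tm.inst₂
  congr 1

end Substitution

/-! ### Typing and substitution -/

section Typing

variable {S : Signature}

theorem HasType.rename {Γ : List Ty} {M : Tm S.Op} {σ : Ty} (h : HasType S Γ M σ) :
    ∀ {Δ : List Ty} {ρ : ℕ → ℕ}, (∀ i τ, Γ[i]? = some τ → Δ[ρ i]? = some τ) →
      HasType S Δ (M.rename ρ) σ := by
  have lift : ∀ {Γ Δ : List Ty} {ρ : ℕ → ℕ} (α : Ty),
      (∀ i τ, Γ[i]? = some τ → Δ[ρ i]? = some τ) →
      ∀ i τ, (α :: Γ)[i]? = some τ → (α :: Δ)[liftRen ρ i]? = some τ := by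
    intro Γ Δ ρ α h i τ hi
    cases i with
    | zero => exact hi
    | succ i => exact h i τ hi
  induction h with
  | var h => intro Δ ρ hρ; exact .var (hρ _ _ h)
  | bool b => intros; exact .bool b
  | num n => intros; exact .num n
  | ite _ _ _ h₁ h₂ h₃ => intro Δ ρ hρ; exact .ite (h₁ hρ) (h₂ hρ) (h₃ hρ)
  | op o _ _ h₁ h₂ => intro Δ ρ hρ; exact .op o (h₁ hρ) (h₂ hρ)
  | lam _ h => intro Δ ρ hρ; exact .lam (h (lift _ hρ))
  | choice _ _ h₁ h₂ => intro Δ ρ hρ; exact .choice (h₁ hρ) (h₂ hρ)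
  | app _ _ h₁ h₂ => intro Δ ρ hρ; exact .app (h₁ hρ) (h₂ hρ)
  | fix _ h => intro Δ ρ hρ; exact .fix (h (lift _ hρ))
  | pair _ _ h₁ h₂ => intro Δ ρ hρ; exact .pair (h₁ hρ) (h₂ hρ)
  | fst _ h => intro Δ ρ hρ; exact .fst (h hρ)
  | snd _ h => intro Δ ρ hρ; exact .snd (h hρ)
  | nil => intros; exact .nil
  | cons _ _ h₁ h₂ => intro Δ ρ hρ; exact .cons (h₁ hρ) (h₂ hρ)
  | caseList _ _ _ h₁ h₂ h₃ =>
    intro Δ ρ hρ; exact .caseList (h₁ hρ) (h₂ hρ) (h₃ (lift _ (lift _ hρ)))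

theorem HasType.weaken {Γ : List Ty} {M : Tm S.Op} {σ : Ty} (h : HasType S Γ M σ) (α : Ty) :
    HasType S (α :: Γ) (M.rename Nat.succ) σ :=
  h.rename fun _ _ h => h

theorem HasType.subst {Γ : List Ty} {M : Tm S.Op} {σ : Ty} (h : HasType S Γ M σ) :
    ∀ {Δ : List Ty} {θ : ℕ → Tm S.Op}, (∀ i τ, Γ[i]? = some τ → HasType S Δ (θ i) τ) →
      HasType S Δ (M.subst θ) σ := by
  have lift : ∀ {Γ Δ : List Ty} {θ : ℕ → Tm S.Op} (α : Ty),
      (∀ i τ, Γ[i]? = some τ → HasType S Δ (θ i) τ) →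
      ∀ i τ, (α :: Γ)[i]? = some τ → HasType S (α :: Δ) (liftSub θ i) τ := by
    intro Γ Δ θ α h i τ hi
    cases i with
    | zero => exact .var hi
    | succ i => exact (h i τ hi).weaken α
  induction h with
  | var h => intro Δ θ hθ; exact hθ _ _ h
  | bool b => intros; exact .bool b
  | num n => intros; exact .num n
  | ite _ _ _ h₁ h₂ h₃ => intro Δ θ hθ; exact .ite (h₁ hθ) (h₂ hθ) (h₃ hθ)
  | op o _ _ h₁ h₂ => intro Δ θ hθ; exact .op o (h₁ hθ) (h₂ hθ)
  | lam _ h => intro Δ θ hθ; exact .lam (h (lift _ hθ))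
  | choice _ _ h₁ h₂ => intro Δ θ hθ; exact .choice (h₁ hθ) (h₂ hθ)
  | app _ _ h₁ h₂ => intro Δ θ hθ; exact .app (h₁ hθ) (h₂ hθ)
  | fix _ h => intro Δ θ hθ; exact .fix (h (lift _ hθ))
  | pair _ _ h₁ h₂ => intro Δ θ hθ; exact .pair (h₁ hθ) (h₂ hθ)
  | fst _ h => intro Δ θ hθ; exact .fst (h hθ)
  | snd _ h => intro Δ θ hθ; exact .snd (h hθ)
  | nil => intros; exact .nil
  | cons _ _ h₁ h₂ => intro Δ θ hθ; exact .cons (h₁ hθ) (h₂ hθ)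
  | caseList _ _ _ h₁ h₂ h₃ =>
    intro Δ θ hθ; exact .caseList (h₁ hθ) (h₂ hθ) (h₃ (lift _ (lift _ hθ)))

/-- Only the variables of the typing context matter for substitution. -/
theorem HasType.subst_congr {Γ : List Ty} {M : Tm S.Op} {σ : Ty} (h : HasType S Γ M σ) :
    ∀ {θ ξ : ℕ → Tm S.Op}, (∀ i τ, Γ[i]? = some τ → θ i = ξ i) → M.subst θ = M.subst ξ := by
  have lift : ∀ {Γ : List Ty} {θ ξ : ℕ → Tm S.Op} (α : Ty),
      (∀ i τ, Γ[i]? = some τ → θ i = ξ i) →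
      ∀ i τ, (α :: Γ)[i]? = some τ → liftSub θ i = liftSub ξ i := by
    intro Γ θ ξ α h i τ hi
    cases i with
    | zero => rfl
    | succ i => exact congrArg (Tm.rename Nat.succ) (h i τ hi)
  induction h with
  | var h => intro θ ξ e; exact e _ _ h
  | bool b => intros; rfl
  | num n => intros; rfl
  | nil => intros; rfl
  | ite _ _ _ h₁ h₂ h₃ => intro θ ξ e; simp only [Tm.subst, h₁ e, h₂ e, h₃ e]
  | op o _ _ h₁ h₂ | choice _ _ h₁ h₂ | app _ _ h₁ h₂ | pair _ _ h₁ h₂ | cons _ _ h₁ h₂ =>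
    intro θ ξ e; simp only [Tm.subst, h₁ e, h₂ e]
  | lam _ h | fix _ h => intro θ ξ e; simp only [Tm.subst, h (lift _ e)]
  | fst _ h | snd _ h => intro θ ξ e; simp only [Tm.subst, h e]
  | caseList _ _ _ h₁ h₂ h₃ =>
    intro θ ξ e; simp only [Tm.subst, h₁ e, h₂ e, h₃ (lift _ (lift _ e))]

theorem Tm.subst_var (M : Tm S.Op) : M.subst Tm.var = M := by
  induction M <;> simp_all [Tm.subst, liftSub_var]

theorem HasType.subst_closed {M : Tm S.Op} {σ : Ty} (h : HasType S [] M σ) (θ : ℕ → Tm S.Op) :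
    M.subst θ = M := by
  rw [h.subst_congr (ξ := Tm.var) (by simp), Tm.subst_var]

theorem HasType.inst {M V : Tm S.Op} {σ τ : Ty} (h : HasType S [τ] M σ) (hV : HasType S [] V τ) :
    HasType S [] (M.inst V) σ := by
  rw [Tm.inst_eq_subst]
  refine h.subst fun i τ hi => ?_
  cases i with
  | zero => simp at hi; exact hi ▸ hV
  | succ i => simp at hi

theorem IsValue.subst {Op : Type} {V : Tm Op} (h : IsValue V) (θ : ℕ → Tm Op) :
    IsValue (V.subst θ) := by
  cases h <;> constructor

end Typing

/-! ### The semantics as a least fixed point -/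

section Cont

variable {I : Type}

/-- Monotone convergence for sums. -/
theorem tsum_iSup_of_monotone {α : Type} {f : ℕ → α → ℝ≥0∞} (hf : Monotone f) :
    ∑' a, ⨆ n, f n a = ⨆ n, ∑' a, f n a := by
  -- With the discrete σ-algebra every function is measurable, and the sum is the integral against
  -- counting measure.
  let _ : MeasurableSpace α := ⊤
  have := MeasureTheory.lintegral_iSup (μ := MeasureTheory.Measure.count)
    (fun n => measurable_from_top (f := f n)) hf
  simpa only [MeasureTheory.lintegral_count] using this

/-- Diagonal argument: the pair of indices `i`, `j` is dominated by their maximum. -/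
theorem iSup_mul_iSup_of_monotone {f g : ℕ → ℝ≥0∞} (hf : Monotone f) (hg : Monotone g) :
    (⨆ n, f n) * (⨆ n, g n) = ⨆ n, f n * g n := by
  refine le_antisymm ?_ (iSup_le fun n => mul_le_mul' (le_iSup f n) (le_iSup g n))
  rw [ENNReal.iSup_mul]
  refine iSup_le fun i => ?_
  rw [ENNReal.mul_iSup]
  exact iSup_le fun j => le_iSup_of_le (max i j)
    (mul_le_mul' (hf (le_max_left i j)) (hg (le_max_right i j)))

/-- Monotone functionals that preserve suprema of increasing sequences. -/
structure OmegaCont (F : (I → ℝ≥0∞) → ℝ≥0∞) : Prop where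
  mono : Monotone F
  map_iSup : ∀ A : ℕ → I → ℝ≥0∞, Monotone A → F (⨆ n, A n) = ⨆ n, F (A n)

theorem OmegaCont.const (c : ℝ≥0∞) : OmegaCont fun _ : I → ℝ≥0∞ => c :=
  ⟨monotone_const, fun _ _ => by simp⟩

theorem OmegaCont.eval (i : I) : OmegaCont fun A : I → ℝ≥0∞ => A i :=
  ⟨fun _ _ h => h i, fun _ _ => iSup_apply⟩

theorem OmegaCont.mul {F G : (I → ℝ≥0∞) → ℝ≥0∞} (hF : OmegaCont F) (hG : OmegaCont G) :
    OmegaCont fun A => F A * G A :=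
  ⟨fun _ _ h => mul_le_mul' (hF.mono h) (hG.mono h), fun A hA => by
    rw [hF.map_iSup A hA, hG.map_iSup A hA]
    exact iSup_mul_iSup_of_monotone (hF.mono.comp hA) (hG.mono.comp hA)⟩

theorem OmegaCont.add {F G : (I → ℝ≥0∞) → ℝ≥0∞} (hF : OmegaCont F) (hG : OmegaCont G) :
    OmegaCont fun A => F A + G A :=
  ⟨fun _ _ h => add_le_add (hF.mono h) (hG.mono h), fun A hA => by
    rw [hF.map_iSup A hA, hG.map_iSup A hA]
    exact ENNReal.iSup_add_iSup_of_monotone (hF.mono.comp hA) (hG.mono.comp hA)⟩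

theorem OmegaCont.tsum {α : Type} {F : α → (I → ℝ≥0∞) → ℝ≥0∞} (hF : ∀ a, OmegaCont (F a)) :
    OmegaCont fun A => ∑' a, F a A :=
  ⟨fun _ _ h => ENNReal.tsum_le_tsum fun a => (hF a).mono h, fun A hA => by
    rw [tsum_congr fun a => (hF a).map_iSup A hA,
      tsum_iSup_of_monotone (f := fun n a => F a (A n)) fun _ _ h a => (hF a).mono (hA h)]⟩

end Cont

/-! ### The one-step unfolding, its iterates, and the semantics as their supremum. -/

section Denote

variable {S : Signature}

/-- One unfolding of the big-step semantics, where `A` describes the subcomputations. -/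
noncomputable def stepDist (S : Signature) (A : Tm S.Op × Tm S.Op → ℝ≥0∞) :
    Tm S.Op → Tm S.Op → ℝ≥0∞
  | .op o M N, X => ∑' i : ℕ, ∑' j : ℕ,
      A (M, .num i) * A (N, .num j) * dirac ((S.sem o).result i j) X
  | .app M N, X => ∑' V, A (N, V) *
      ((∑' P, A (M, .lam P) * A (P.inst V, X)) +
        ∑' Q, A (M, .fix Q) * A (.app (Q.inst (.fix Q)) V, X))
  | .ite L M N, X => A (L, .bool true) * A (M, X) + A (L, .bool false) * A (N, X)
  | .caseList L M N, X => A (L, .nil) * A (M, X) +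
      ∑' H, ∑' T, ∑' V, ∑' W, A (L, .cons H T) * A (H, V) * A (T, W) * A (N.inst₂ V W, X)
  | .fst M, X => ∑' P, ∑' N, A (M, .pair P N) * A (P, X)
  | .snd M, X => ∑' P, ∑' N, A (M, .pair P N) * A (N, X)
  | .choice M N, X => 2⁻¹ * A (M, X) + 2⁻¹ * A (N, X)
  -- A variable has only the empty derivation. The constructors left for the next clause are exactly
  -- the values.
  | .var _, _ => 0
  | M, X => dirac M X

theorem stepDist_value {V : Tm S.Op} (hV : IsValue V) (A : Tm S.Op × Tm S.Op → ℝ≥0∞) :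
    stepDist S A V = dirac V := by
  cases hV <;> rfl

/-- Each clause is built from constants and evaluations by products and sums with nonnegative
coefficients. This continuity is what makes the supremum of the iterates a fixed point. -/
theorem stepDist_omegaCont (M X : Tm S.Op) : OmegaCont fun A => stepDist S A M X := by
  cases M with
  | var => exact .const 0
  | num | bool | nil | pair | cons | lam | fix => exact .const _
  | choice M N =>
    exact .add (.mul (.const _) (.eval (M, X))) (.mul (.const _) (.eval (N, X)))
  | ite L M N =>
    exact .add (.mul (.eval (L, _)) (.eval (M, X))) (.mul (.eval (L, _)) (.eval (N, X)))
  | op o M N =>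
    exact .tsum fun i => .tsum fun j => .mul (.mul (.eval (M, _)) (.eval (N, _))) (.const _)
  | fst M => exact .tsum fun P => .tsum fun N => .mul (.eval (M, _)) (.eval (P, X))
  | snd M => exact .tsum fun P => .tsum fun N => .mul (.eval (M, _)) (.eval (N, X))
  | caseList L M N =>
    exact .add (.mul (.eval (L, _)) (.eval (M, X))) <| .tsum fun H => .tsum fun T =>
      .tsum fun V => .tsum fun W => .mul (.mul (.mul (.eval (L, _)) (.eval (H, V)))
        (.eval (T, W))) (.eval (N.inst₂ V W, X))
  | app M N =>
    exact .tsum fun V => .mul (.eval (N, V)) (.add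
      (.tsum fun P => .mul (.eval (M, _)) (.eval (P.inst V, X)))
      (.tsum fun Q => .mul (.eval (M, _)) (.eval (Tm.app (Q.inst (.fix Q)) V, X))))

/-- The value distribution reached within `n` unfoldings. -/
noncomputable def approx (S : Signature) : ℕ → Tm S.Op × Tm S.Op → ℝ≥0∞
  | 0 => 0
  | n + 1 => fun p => stepDist S (approx S n) p.1 p.2

theorem approx_mono : Monotone (approx S) := by
  refine monotone_nat_of_le_succ fun n => ?_
  induction n with
  | zero => exact fun _ => zero_le
  | succ n ih => exact fun p => (stepDist_omegaCont p.1 p.2).mono ih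

/-- Each iterate is itself derivable: the previous iterate supplies all premises at once, including
the families indexed by supports. -/
theorem eval_approx (n : ℕ) (M : Tm S.Op) : Eval S M fun X => approx S n (M, X) := by
  induction n generalizing M with
  | zero => exact .empty M
  | succ n ih =>
    cases M with
    | var i => exact .empty _
    | num k => exact .value (.num k)
    | bool b => exact .value (.bool b)
    | nil => exact .value .nil
    | pair M N => exact .value (.pair M N)
    | cons M N => exact .value (.cons M N)
    | lam M => exact .value (.lam M)
    | fix M => exact .value (.fix M)
    | choice M N => exact .choice (ih M) (ih N)
    | ite L M N => exact .ite (ih L) (ih M) (ih N)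
    | op o M N => exact .op o (ih M) (ih N)
    | fst M => exact .fst (ih M) fun P _ _ => ih P
    | snd M => exact .snd (ih M) fun _ N _ => ih N
    | caseList L M N =>
      exact .caseList (ih L) (ih M) (fun H _ _ => ih H) (fun _ T _ => ih T)
        (fun _ _ V W _ _ _ => ih (N.inst₂ V W))
    | app M N =>
      exact .app (ih M) (ih N) (fun P V _ _ => ih (P.inst V))
        (fun Q V _ _ => ih (.app (Q.inst (.fix Q)) V))

theorem stepDist_iSup_approx (M X : Tm S.Op) :
    stepDist S (⨆ n, approx S n) M X = (⨆ n, approx S n) (M, X) := by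
  rw [(stepDist_omegaCont M X).map_iSup _ approx_mono, iSup_apply]
  -- Unfolding shifts the index by one, which leaves the supremum of an increasing sequence
  -- unchanged.
  exact Monotone.iSup_nat_add (f := fun n => approx S n (M, X)) (fun _ _ h => approx_mono h _) 1

/-- The supremum is a fixed point of the unfolding, so bounds on the premises pass to the conclusion
of each rule. Premises exist only over supports, hence the products are compared only where the
weight is nonzero. -/
theorem Eval.le_iSup_approx {M : Tm S.Op} {D : Tm S.Op → ℝ≥0∞} (h : Eval S M D) (X : Tm S.Op) :
    D X ≤ (⨆ n, approx S n) (M, X) := by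
  induction h generalizing X with
  | empty M => exact zero_le
  | value hV => rw [← stepDist_iSup_approx, stepDist_value hV]
  | op o _ _ h₁ h₂ =>
    rw [← stepDist_iSup_approx]
    exact ENNReal.tsum_le_tsum fun i => ENNReal.tsum_le_tsum fun j =>
      mul_le_mul' (mul_le_mul' (h₁ _) (h₂ _)) le_rfl
  | app _ _ _ _ h₁ h₂ h₃ h₄ =>
    rw [← stepDist_iSup_approx]
    exact ENNReal.tsum_le_tsum fun V => mul_mono_of_ne_zero (h₂ V) fun hV => add_le_add
      (ENNReal.tsum_le_tsum fun P => mul_mono_of_ne_zero (h₁ _) fun h => h₃ P V h hV X)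
      (ENNReal.tsum_le_tsum fun Q => mul_mono_of_ne_zero (h₁ _) fun h => h₄ Q V h hV X)
  | ite _ _ _ h₁ h₂ h₃ =>
    rw [← stepDist_iSup_approx]
    exact add_le_add (mul_le_mul' (h₁ _) (h₂ X)) (mul_le_mul' (h₁ _) (h₃ X))
  | caseList _ _ _ _ _ h₁ h₂ h₃ h₄ h₅ =>
    rw [← stepDist_iSup_approx]
    refine add_le_add (mul_le_mul' (h₁ _) (h₂ X)) <| ENNReal.tsum_le_tsum fun H =>
      ENNReal.tsum_le_tsum fun T => ENNReal.tsum_le_tsum fun V =>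
      ENNReal.tsum_le_tsum fun W => mul_mono_of_ne_zero (mul_mono_of_ne_zero (mul_mono_of_ne_zero
        (h₁ _) fun h => h₃ H T h V) fun h => h₄ H T (left_ne_zero_of_mul h) W) fun h => ?_
    exact h₅ H T V W (left_ne_zero_of_mul (left_ne_zero_of_mul h))
      (right_ne_zero_of_mul (left_ne_zero_of_mul h)) (right_ne_zero_of_mul h) X
  | fst _ _ h₁ h₂ =>
    rw [← stepDist_iSup_approx]
    exact ENNReal.tsum_le_tsum fun P => ENNReal.tsum_le_tsum fun N =>
      mul_mono_of_ne_zero (h₁ _) fun h => h₂ P N h X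
  | snd _ _ h₁ h₂ =>
    rw [← stepDist_iSup_approx]
    exact ENNReal.tsum_le_tsum fun P => ENNReal.tsum_le_tsum fun N =>
      mul_mono_of_ne_zero (h₁ _) fun h => h₂ P N h X
  | choice _ _ h₁ h₂ =>
    rw [← stepDist_iSup_approx]
    exact add_le_add (mul_le_mul' le_rfl (h₁ X)) (mul_le_mul' le_rfl (h₂ X))

/-- This replaces the supremum over all derivations by that of an increasing sequence, to which
monotone convergence and induction on the index apply. -/
theorem denote_eq_iSup_approx (M X : Tm S.Op) : denote S M X = (⨆ n, approx S n) (M, X) := by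
  refine le_antisymm ?_ ?_
  · rw [denote, sSup_apply]
    exact iSup_le fun D => D.2.le_iSup_approx X
  · rw [iSup_apply]
    exact iSup_le fun n => le_sSup (α := Tm S.Op → ℝ≥0∞) (eval_approx n M) X

/-- The big-step semantics is a fixed point of the unfolding. -/
theorem stepDist_denote (M : Tm S.Op) :
    stepDist S (fun p => denote S p.1 p.2) M = denote S M := by
  funext X
  rw [denote_eq_iSup_approx, ← stepDist_iSup_approx]
  congr 1
  funext p
  exact denote_eq_iSup_approx p.1 p.2

theorem denote_value {V : Tm S.Op} (hV : IsValue V) : denote S V = dirac V := by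
  rw [← stepDist_denote, stepDist_value hV]

end Denote

/-! ### Similarity in labelled Markov chains -/

section LayerCake

/-- The levels range over the positive reals so that Lebesgue measure can be used; the value `⊤`
corresponds to the whole half-line. -/
theorem volume_lt_ofReal (a : ℝ≥0∞) :
    MeasureTheory.volume {r : ℝ | 0 < r ∧ ENNReal.ofReal r < a} = a := by
  by_cases ha : a = ⊤
  · subst ha
    have : {r : ℝ | 0 < r ∧ ENNReal.ofReal r < ⊤} = Set.Ioi 0 := by ext r; simp
    rw [this, Real.volume_Ioi]
  · have : {r : ℝ | 0 < r ∧ ENNReal.ofReal r < a} = Set.Ioo 0 a.toReal := by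
      ext r
      simp only [Set.mem_ofPred_eq, Set.mem_Ioo]
      exact and_congr_right fun hr => ENNReal.ofReal_lt_iff_lt_toReal hr.le ha
    rw [this, Real.volume_Ioo, sub_zero, ENNReal.ofReal_toReal ha]

theorem measurableSet_lt_ofReal (a : ℝ≥0∞) :
    MeasurableSet {r : ℝ | 0 < r ∧ ENNReal.ofReal r < a} :=
  (measurableSet_lt measurable_const measurable_id).inter
    (measurableSet_lt ENNReal.measurable_ofReal measurable_const)

/-- Layer cake formula for weighted sums. -/
theorem tsum_mul_eq_lintegral {α : Type} [Countable α] (p f : α → ℝ≥0∞) :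
    ∑' x, p x * f x =
      ∫⁻ r : ℝ, ∑' x : {x | 0 < r ∧ ENNReal.ofReal r < f x}, p x := by
  -- The same inequality is read once as a condition on the point and once as a condition on the
  -- level; exchanging the two is Tonelli, which uses countability of `α`.
  have h : ∀ (x : α) (r : ℝ), {x | 0 < r ∧ ENNReal.ofReal r < f x}.indicator p x =
      {r : ℝ | 0 < r ∧ ENNReal.ofReal r < f x}.indicator (fun _ => p x) r := fun _ _ => rfl
  simp_rw [tsum_subtype, h]
  rw [MeasureTheory.lintegral_tsum fun x =>
    (measurable_const.indicator (measurableSet_lt_ofReal (f x))).aemeasurable]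
  refine tsum_congr fun x => ?_
  rw [MeasureTheory.lintegral_indicator_const (measurableSet_lt_ofReal _), volume_lt_ofReal]

end LayerCake

/-! ### Simulations and bisimulations in an arbitrary chain. -/

namespace LMC

variable {C : LMC}

theorem prob_mono (s : C.State) (l : C.Label) {X Y : Set C.State} (h : X ⊆ Y) :
    C.prob s l X ≤ C.prob s l Y :=
  ENNReal.tsum_mono_subtype _ h

theorem prob_ne_top (s : C.State) (l : C.Label) (X : Set C.State) : C.prob s l X ≠ ⊤ := by
  refine ne_top_of_le_ne_top ENNReal.one_ne_top (le_trans ?_ (C.tsum_le_one s l))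
  exact ENNReal.tsum_comp_le_tsum_of_injective Subtype.val_injective _

theorem prob_union (s : C.State) (l : C.Label) {X Y : Set C.State} (h : Disjoint X Y) :
    C.prob s l (X ∪ Y) = C.prob s l X + C.prob s l Y :=
  Summable.tsum_union_disjoint h ENNReal.summable ENNReal.summable

/-- Comparison of expectations along a relation from comparison of probabilities. -/
theorem tsum_mul_le_of_prob_le {s t : C.State} {l : C.Label} {R : C.State → C.State → Prop}
    (h : ∀ X : Set C.State, C.prob s l X ≤ C.prob t l {y | ∃ x ∈ X, R x y})
    {f g : C.State → ℝ≥0∞} (hfg : ∀ x y, R x y → f x ≤ g y) :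
    ∑' x, C.P s l x * f x ≤ ∑' y, C.P t l y * g y := by
  have := C.countable
  rw [tsum_mul_eq_lintegral, tsum_mul_eq_lintegral]
  -- At each level `r`, the relation carries the superlevel set of `f` into that of `g`.
  refine MeasureTheory.lintegral_mono fun r => (h _).trans (prob_mono t l ?_)
  rintro y ⟨x, ⟨hr, hx⟩, hxy⟩
  exact ⟨hr, hx.trans_le (hfg x y hxy)⟩

/-- Simulations must be preorders, which natural candidates need not be. Matching each single step
up to the closure suffices, because the inequalities compose along a path. -/
theorem isSimulation_reflTransGen {Q : C.State → C.State → Prop}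
    (h : ∀ s t, Q s t → ∀ (l : C.Label) (X : Set C.State),
      C.prob s l X ≤ C.prob t l {y | ∃ x ∈ X, Relation.ReflTransGen Q x y}) :
    C.IsSimulation (Relation.ReflTransGen Q) where
  refl _ := .refl
  trans _ _ _ := .trans
  sim s t hst l X := by
    induction hst with
    | refl => exact prob_mono s l fun x hx => ⟨x, hx, .refl⟩
    | tail _ hq ih =>
      refine ih.trans ((h _ _ hq l _).trans (prob_mono _ l ?_))
      rintro z ⟨y, ⟨x, hx, hxy⟩, hyz⟩
      exact ⟨x, hx, hxy.trans hyz⟩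

/-- Similarity is the largest simulation. -/
theorem isSimulation_similar (C : LMC) : C.IsSimulation C.Similar := by
  have hs : C.IsSimulation (Relation.ReflTransGen C.Similar) := by
    refine isSimulation_reflTransGen fun s t ⟨R, hR, hst⟩ l X => ?_
    refine (hR.sim s t hst l X).trans (prob_mono t l ?_)
    rintro y ⟨x, hx, hxy⟩
    exact ⟨x, hx, .single ⟨R, hR, hxy⟩⟩
  have : Relation.ReflTransGen C.Similar = C.Similar := by
    funext s t
    exact propext ⟨fun h => ⟨_, hs, h⟩, .single⟩
  rwa [this] at hs

theorem Similar.refl (s : C.State) : C.Similar s s := C.isSimulation_similar.refl s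

theorem Similar.trans {s t u : C.State} (h : C.Similar s t) (h' : C.Similar t u) :
    C.Similar s u := C.isSimulation_similar.trans s t u h h'

theorem Similar.prob_le {s t : C.State} (h : C.Similar s t) (l : C.Label) (X : Set C.State) :
    C.prob s l X ≤ C.prob t l {y | ∃ x ∈ X, C.Similar x y} :=
  C.isSimulation_similar.sim s t h l X

/-- A set closed under an equivalence relation is a disjoint union of classes, so its mass is the
sum of the masses of those classes. -/
theorem IsBisimulation.prob_saturated {R : C.State → C.State → Prop} (hR : C.IsBisimulation R)
    {s t : C.State} (hst : R s t) (l : C.Label) {X : Set C.State}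
    (hX : ∀ x y, R x y → x ∈ X → y ∈ X) : C.prob s l X = C.prob t l X := by
  let r : Setoid C.State := ⟨R, hR.equiv⟩
  have key : ∀ u, C.prob u l X =
      ∑' q : Quotient r, ∑' y : (Quotient.mk r ⁻¹' {q} : Set C.State),
        X.indicator (C.P u l) y := by
    intro u
    rw [ENNReal.tsum_fiberwise (X.indicator (C.P u l)) (Quotient.mk r), ← tsum_subtype]
    rfl
  rw [key, key]
  refine tsum_congr fun q => ?_
  induction q using Quotient.inductionOn with
  | h u =>
    have hq : (Quotient.mk r ⁻¹' {Quotient.mk r u} : Set C.State) = {y | R u y} := by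
      ext y
      rw [Set.mem_preimage, Set.mem_singleton_iff, Set.mem_ofPred_eq]
      exact ⟨fun h => hR.equiv.symm (Quotient.exact h), fun h => Quotient.sound (hR.equiv.symm h)⟩
    rw [hq]
    -- By saturation a class lies inside `X` or misses it altogether.
    by_cases hu : u ∈ X
    · have : ∀ v, ∑' y : {y | R u y}, X.indicator (C.P v l) y = C.prob v l {y | R u y} :=
        fun v => tsum_congr fun y => Set.indicator_of_mem (hX u y y.2 hu) _
      rw [this, this, hR.bisim s t hst l u]
    · have : ∀ v, ∑' y : {y | R u y}, X.indicator (C.P v l) y = 0 := fun v =>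
        ENNReal.tsum_eq_zero.2 fun y =>
          Set.indicator_of_notMem (fun hy => hu (hX y u (hR.equiv.symm y.2) hy)) _
      rw [this, this]

/-- Enlarging `X` to its saturation only increases the left mass, and saturated sets have equal mass
from related states. -/
theorem IsBisimulation.isSimulation {R : C.State → C.State → Prop} (hR : C.IsBisimulation R) :
    C.IsSimulation R where
  refl := hR.equiv.refl
  trans _ _ _ := hR.equiv.trans
  sim s t hst l X := by
    refine (prob_mono s l ?_).trans
      (hR.prob_saturated hst l (X := {y | ∃ x ∈ X, R x y}) ?_).le
    · exact fun x hx => ⟨x, hx, hR.equiv.refl x⟩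
    rintro x y hxy ⟨z, hz, hzx⟩
    exact ⟨z, hz, hR.equiv.trans hzx hxy⟩

/-- The class of `u` is the set of states above `u` minus the set of states strictly above `u`. Both
sets are upward closed, so mutually similar states give them equal mass, and the masses can be
subtracted. -/
theorem isBisimulation_similar_inter (C : LMC) :
    C.IsBisimulation fun s t => C.Similar s t ∧ C.Similar t s where
  equiv := ⟨fun s => ⟨.refl s, .refl s⟩, fun h => ⟨h.2, h.1⟩,
    fun h h' => ⟨h.1.trans h'.1, h'.2.trans h.2⟩⟩
  bisim s t hst l u := by
    have up : ∀ {s t : C.State}, C.Similar s t → ∀ {X : Set C.State},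
        (∀ x y, C.Similar x y → x ∈ X → y ∈ X) → C.prob s l X ≤ C.prob t l X := by
      intro s t h X hX
      refine (h.prob_le l X).trans (prob_mono t l ?_)
      rintro y ⟨x, hx, hxy⟩
      exact hX x y hxy hx
    have eq : ∀ {X : Set C.State}, (∀ x y, C.Similar x y → x ∈ X → y ∈ X) →
        C.prob s l X = C.prob t l X := fun hX => le_antisymm (up hst.1 hX) (up hst.2 hX)
    have split : ∀ v, C.prob v l {y | C.Similar u y} =
        C.prob v l {y | C.Similar u y ∧ C.Similar y u} +
          C.prob v l {y | C.Similar u y ∧ ¬ C.Similar y u} := by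
      intro v
      rw [← prob_union]
      · congr 1
        ext y
        simp only [Set.mem_ofPred_eq, Set.mem_union]
        tauto
      · exact Set.disjoint_left.2 fun y h h' => h'.2 h.2
    have h₁ : C.prob s l {y | C.Similar u y} = C.prob t l {y | C.Similar u y} :=
      eq fun x y hxy hx => Similar.trans hx hxy
    have h₂ : C.prob s l {y | C.Similar u y ∧ ¬ C.Similar y u} =
        C.prob t l {y | C.Similar u y ∧ ¬ C.Similar y u} :=
      eq fun x y hxy hx => ⟨hx.1.trans hxy, fun h => hx.2 (hxy.trans h)⟩
    rw [split, split, h₂] at h₁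
    -- Cancellation is legitimate because rows are sub-stochastic, hence of finite mass.
    exact (ENNReal.add_left_inj (prob_ne_top t l _)).1 h₁

/-- Bisimilarity is mutual similarity. -/
theorem bisimilar_iff {s t : C.State} : C.Bisimilar s t ↔ C.Similar s t ∧ C.Similar t s :=
  ⟨fun ⟨R, hR, h⟩ => ⟨⟨R, hR.isSimulation, h⟩, ⟨R, hR.isSimulation, hR.equiv.symm h⟩⟩,
    fun h => ⟨_, C.isBisimulation_similar_inter, h⟩⟩

end LMC

/-! ### Similarity of programs -/

section Chain

variable {S : Signature}

theorem transProb_of_detStep {s t : State S} {l : Label S} (h : DetStep S s l t) :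
    transProb S s l t = 1 := by
  cases h <;> exact if_pos (by constructor <;> assumption)

/-- The hypothesis on `l` excludes the only genuinely probabilistic rows, those of `eval` at term
states. -/
theorem detStep_of_transProb_ne_zero {s t : State S} {l : Label S}
    (hs : l = .eval → ∃ v, s = .inr v) (h : transProb S s l t ≠ 0) : DetStep S s l t := by
  by_contra hd
  refine h ?_
  rcases s with s | s <;> rcases t with t | t <;> cases l <;> simp_all [transProb]

theorem transProb_eval_inl (M : TermState S) (N : TermState S) :
    transProb S (.inl M) .eval (.inl N) = 0 := by
  simp only [transProb]
  exact if_neg fun h => by cases h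

theorem LMC.exists_of_prob_ne_zero {C : LMC} {s : C.State} {l : C.Label} {X : Set C.State}
    (h : C.prob s l X ≠ 0) : ∃ t ∈ X, C.P s l t ≠ 0 := by
  by_contra hc
  push Not at hc
  exact h (ENNReal.tsum_eq_zero.2 fun t => hc t t.2)

theorem LMC.le_prob {C : LMC} {s t : C.State} {l : C.Label} {X : Set C.State} (h : t ∈ X) :
    C.P s l t ≤ C.prob s l X :=
  ENNReal.le_tsum (f := fun t : X => C.P s l t) ⟨t, h⟩

theorem LMC.prob_le_one {C : LMC} (s : C.State) (l : C.Label) (X : Set C.State) :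
    C.prob s l X ≤ 1 :=
  (ENNReal.tsum_comp_le_tsum_of_injective Subtype.val_injective _).trans (C.tsum_le_one s l)

/-- The row of `s` is zero or a point mass. If `X` receives mass, the successor of `s` lies in it,
and a single matching successor of `t` already carries mass `1`. -/
theorem prob_le_of_detStep {s t : State S} {l : Label S} (hs : l = .eval → ∃ v, s = .inr v)
    {R : State S → State S → Prop}
    (h : ∀ s', DetStep S s l s' → ∃ t', DetStep S t l t' ∧ R s' t') (X : Set (State S)) :
    (chain S).prob s l X ≤ (chain S).prob t l {y | ∃ x ∈ X, R x y} := by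
  by_cases h0 : (chain S).prob s l X = 0
  · exact h0 ▸ zero_le
  · obtain ⟨s', hs', hp⟩ := LMC.exists_of_prob_ne_zero h0
    obtain ⟨t', ht', hR⟩ := h s' (detStep_of_transProb_ne_zero hs hp)
    refine (LMC.prob_le_one (C := chain S) s l X).trans ?_
    rw [← transProb_of_detStep ht']
    exact LMC.le_prob (C := chain S) ⟨s', hs', hR⟩

/-- Testing the simulation condition on the singleton of the successor forces `t` to reach some
state above it with positive probability. -/
theorem similar_detStep {s t s' : State S} {l : Label S} (h : (chain S).Similar s t)
    (ht : l = .eval → ∃ v, t = .inr v) (hs : DetStep S s l s') :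
    ∃ t', DetStep S t l t' ∧ (chain S).Similar s' t' := by
  have h1 := (LMC.le_prob (C := chain S) (s := s) (l := l) (Set.mem_singleton s')).trans
    (h.prob_le l {s'})
  have h2 : (chain S).P s l s' = 1 := transProb_of_detStep hs
  rw [h2] at h1
  obtain ⟨t', ⟨_, rfl, h3⟩, h4⟩ := LMC.exists_of_prob_ne_zero
    (ne_of_gt (lt_of_lt_of_le zero_lt_one h1))
  exact ⟨t', detStep_of_transProb_ne_zero ht h4, h3⟩

/-! ### Similarity on distinguished values and what it forces on their shape. -/

/-- Similarity of the distinguished values `V`, `W` of type `σ`. -/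
def ValueSim (S : Signature) (σ : Ty) (V W : Tm S.Op) : Prop :=
  ∃ (hV : IsValue V ∧ HasType S [] V σ) (hW : IsValue W ∧ HasType S [] W σ),
    (chain S).Similar (.inr ⟨(V, σ), hV⟩) (.inr ⟨(W, σ), hW⟩)

theorem ClosedSim.refl {σ : Ty} {M : Tm S.Op} (h : HasType S [] M σ) : ClosedSim S σ M M :=
  ⟨h, h, .refl _⟩

theorem ClosedSim.trans {σ : Ty} {M N L : Tm S.Op} (h : ClosedSim S σ M N)
    (h' : ClosedSim S σ N L) : ClosedSim S σ M L := by
  obtain ⟨hM, _, h⟩ := h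
  obtain ⟨_, hL, h'⟩ := h'
  exact ⟨hM, hL, h.trans h'⟩

theorem transProb_value {σ : Ty} {V : Tm S.Op} (hV : IsValue V ∧ HasType S [] V σ) :
    transProb S (.inl ⟨(V, σ), hV.2⟩) .eval (.inr ⟨(V, σ), hV⟩) = 1 := by
  simp [transProb, denote_value hV.1, dirac]

theorem eq_of_transProb_value_ne_zero {σ : Ty} {V : Tm S.Op} (hV : IsValue V ∧ HasType S [] V σ)
    {t : State S} (h : transProb S (.inl ⟨(V, σ), hV.2⟩) .eval t ≠ 0) :
    t = .inr ⟨(V, σ), hV⟩ := by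
  rcases t with t | ⟨⟨W, τ⟩, hW⟩
  · exact absurd (transProb_eval_inl _ _) h
  · simp only [transProb, denote_value hV.1, dirac] at h
    split_ifs at h with h1 h2
    · subst h1; subst h2; rfl
    · exact absurd rfl h
    · exact absurd rfl h

/-- A value evaluates to the point mass at its distinguished copy, so the simulation condition for
`eval` relates exactly the two copies. -/
theorem ClosedSim.valueSim {σ : Ty} {V W : Tm S.Op} (h : ClosedSim S σ V W) (hV : IsValue V)
    (hW : IsValue W) : ValueSim S σ V W := by
  obtain ⟨tV, tW, h⟩ := h
  refine ⟨⟨hV, tV⟩, ⟨hW, tW⟩, ?_⟩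
  have h1 := (LMC.le_prob (C := chain S) (s := .inl ⟨(V, σ), tV⟩) (l := .eval)
    (Set.mem_singleton (.inr ⟨(V, σ), ⟨hV, tV⟩⟩))).trans (h.prob_le .eval _)
  have h2 : (chain S).P (.inl ⟨(V, σ), tV⟩) .eval (.inr ⟨(V, σ), ⟨hV, tV⟩⟩) = 1 :=
    transProb_value ⟨hV, tV⟩
  rw [h2] at h1
  obtain ⟨t', ⟨_, rfl, h3⟩, h4⟩ := LMC.exists_of_prob_ne_zero
    (ne_of_gt (lt_of_lt_of_le zero_lt_one h1))
  rwa [eq_of_transProb_value_ne_zero ⟨hW, tW⟩ h4] at h3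

/-- The term state of a value has only its type label and `eval`. Adjoining the desired pairs to
similarity therefore gives a simulation up to closure: `eval` leads to the distinguished copies, and
the type label stays at the adjoined pair. -/
theorem ValueSim.closedSim {σ : Ty} {V W : Tm S.Op} (h : ValueSim S σ V W) :
    ClosedSim S σ V W := by
  let Q : State S → State S → Prop := fun s t => (chain S).Similar s t ∨
    ∃ (σ : Ty) (V W : Tm S.Op) (hV : IsValue V ∧ HasType S [] V σ)
      (hW : IsValue W ∧ HasType S [] W σ),
      s = .inl ⟨(V, σ), hV.2⟩ ∧ t = .inl ⟨(W, σ), hW.2⟩ ∧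
        (chain S).Similar (.inr ⟨(V, σ), hV⟩) (.inr ⟨(W, σ), hW⟩)
  have hQ : (chain S).IsSimulation (Relation.ReflTransGen Q) := by
    refine LMC.isSimulation_reflTransGen (C := chain S) fun s t hst l X => ?_
    rcases hst with hst | ⟨σ, V, W, hV, hW, rfl, rfl, h⟩
    · refine (hst.prob_le l X).trans (LMC.prob_mono (C := chain S) t l ?_)
      rintro y ⟨x, hx, hxy⟩
      exact ⟨x, hx, .single (.inl hxy)⟩
    · by_cases hl : l = .eval
      · subst hl
        by_cases h0 : (chain S).prob (.inl ⟨(V, σ), hV.2⟩) .eval X = 0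
        · exact h0 ▸ zero_le
        · obtain ⟨x, hx, hp⟩ := LMC.exists_of_prob_ne_zero h0
          obtain rfl := eq_of_transProb_value_ne_zero hV hp
          refine (LMC.prob_le_one (C := chain S) _ _ X).trans ?_
          rw [← transProb_value hW]
          exact LMC.le_prob (C := chain S) (X := {y | ∃ x ∈ X, Relation.ReflTransGen Q x y})
            ⟨_, hx, .single (.inl h)⟩
      · refine prob_le_of_detStep (R := Relation.ReflTransGen Q) (fun h => absurd h hl)
          (fun s' hs' => ?_) X
        cases hs' with
        | tyTerm =>
          exact ⟨_, .tyTerm _, .single (.inr ⟨σ, V, W, hV, hW, rfl, rfl, h⟩)⟩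
  obtain ⟨hV, hW, h⟩ := h
  exact ⟨hV.2, hW.2, Relation.ReflTransGen Q, hQ,
    .single (.inr ⟨σ, V, W, hV, hW, rfl, rfl, h⟩)⟩

/-- Only a pair can answer the labels `fst` and `snd`, so the answers reveal both the shape of `W`
and the similarity of the components. -/
theorem ValueSim.pair {σ τ : Ty} {P Q W : Tm S.Op} (h : ValueSim S (.prod σ τ) (.pair P Q) W) :
    ∃ P' Q', W = .pair P' Q' ∧ ClosedSim S σ P P' ∧ ClosedSim S τ Q Q' := by
  obtain ⟨hV, hW, h⟩ := h
  obtain ⟨tP, tQ⟩ : HasType S [] P σ ∧ HasType S [] Q τ := by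
    cases hV.2 with | pair h₁ h₂ => exact ⟨h₁, h₂⟩
  obtain ⟨t₁, d₁, s₁⟩ := similar_detStep h (fun e => by cases e) (.fst hV tP)
  obtain ⟨t₂, d₂, s₂⟩ := similar_detStep h (fun e => by cases e) (.snd hV tQ)
  cases d₁ with
  | fst _ tP' =>
    cases d₂ with
    | snd _ tQ' => exact ⟨_, _, rfl, ⟨tP, tP', s₁⟩, ⟨tQ, tQ', s₂⟩⟩

theorem ValueSim.cons {σ : Ty} {P Q W : Tm S.Op} (h : ValueSim S (.list σ) (.cons P Q) W) :
    ∃ P' Q', W = .cons P' Q' ∧ ClosedSim S σ P P' ∧ ClosedSim S (.list σ) Q Q' := by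
  obtain ⟨hV, hW, h⟩ := h
  obtain ⟨tP, tQ⟩ : HasType S [] P σ ∧ HasType S [] Q (.list σ) := by
    cases hV.2 with | cons h₁ h₂ => exact ⟨h₁, h₂⟩
  obtain ⟨t₁, d₁, s₁⟩ := similar_detStep h (fun e => by cases e) (.hd hV tP)
  obtain ⟨t₂, d₂, s₂⟩ := similar_detStep h (fun e => by cases e) (.tl hV tQ)
  cases d₁ with
  | hd _ tP' =>
    cases d₂ with
    | tl _ tQ' => exact ⟨_, _, rfl, ⟨tP, tP', s₁⟩, ⟨tQ, tQ', s₂⟩⟩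

theorem ValueSim.nil {σ : Ty} {W : Tm S.Op} (h : ValueSim S (.list σ) .nil W) : W = .nil := by
  obtain ⟨hV, hW, h⟩ := h
  obtain ⟨t₁, d₁, _⟩ := similar_detStep h (fun e => by cases e) (.nil hV)
  cases d₁; rfl

theorem ValueSim.num {k : ℕ} {W : Tm S.Op} (h : ValueSim S .int (.num k) W) : W = .num k := by
  obtain ⟨hV, hW, h⟩ := h
  obtain ⟨t₁, d₁, _⟩ := similar_detStep h (fun e => by cases e) (.num hV)
  cases d₁; rfl

theorem ValueSim.bool {b : Bool} {W : Tm S.Op} (h : ValueSim S .bool (.bool b) W) :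
    W = .bool b := by
  obtain ⟨hV, hW, h⟩ := h
  obtain ⟨t₁, d₁, _⟩ := similar_detStep h (fun e => by cases e) (.bool hV)
  cases d₁; rfl

/-- What the application of the value `V` to the value `U` reduces to. -/
def applyVal {Op : Type} (V U : Tm Op) : Option (Tm Op) :=
  match V with
  | .lam P => some (P.inst U)
  | .fix Q => some (.app (Q.inst (.fix Q)) U)
  | _ => none

/-- The argument is itself a label, so both sides receive the same `U`. An abstraction may be
similar to a fixed point; `applyVal` treats both uniformly. -/
theorem ValueSim.apply {τ θ : Ty} {V W U B : Tm S.Op} (h : ValueSim S (.arr τ θ) V W)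
    (hU : IsValue U) (tU : HasType S [] U τ) (hB : applyVal V U = some B) :
    ∃ B', applyVal W U = some B' ∧ ClosedSim S θ B B' := by
  obtain ⟨hV, hW, h⟩ := h
  obtain ⟨tB, d⟩ : ∃ tB : HasType S [] B θ,
      DetStep S (.inr ⟨(V, .arr τ θ), hV⟩) (.val ⟨U, hU⟩) (.inl ⟨(B, θ), tB⟩) := by
    cases V <;> simp only [applyVal, Option.some.injEq, reduceCtorEq] at hB
    case lam P =>
      subst hB
      cases hV.2 with | lam tP => exact ⟨tP.inst tU, .lam hV hU tU _⟩
    case fix Q =>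
      subst hB
      cases id hV.2 with | fix tQ => exact ⟨.app (tQ.inst hV.2) tU, .fix hV hU tU _⟩
  obtain ⟨t', d', s'⟩ := similar_detStep h (fun e => by cases e) d
  cases d' with
  | lam _ _ _ tB' => exact ⟨_, rfl, tB, tB', s'⟩
  | fix _ _ _ tB' => exact ⟨_, rfl, tB, tB', s'⟩

theorem tsum_eval_le {σ : Ty} {M : Tm S.Op} (hM : HasType S [] M σ) {f : Tm S.Op → ℝ≥0∞}
    {F : State S → ℝ≥0∞} (hF : ∀ v : ValueState S, v.1.2 = σ → F (.inr v) ≤ f v.1.1) :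
    ∑' t, transProb S (.inl ⟨(M, σ), hM⟩) .eval t * F t ≤ ∑' V, denote S M V * f V := by
  rw [Summable.tsum_sum ENNReal.summable ENNReal.summable]
  simp only [transProb_eval_inl, zero_mul, tsum_zero, zero_add]
  have h : ∀ v : ValueState S, transProb S (.inl ⟨(M, σ), hM⟩) .eval (.inr v) * F (.inr v) ≤
      ({v : ValueState S | v.1.2 = σ}).indicator (fun v => denote S M v.1.1 * f v.1.1) v := by
    intro v
    by_cases hv : v.1.2 = σ
    · simp only [transProb, Set.indicator, Set.mem_ofPred_eq, hv, if_true]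
      exact mul_le_mul' le_rfl (hF v hv)
    · simp [transProb, hv]
  refine (ENNReal.tsum_le_tsum h).trans ?_
  rw [← tsum_subtype]
  refine ENNReal.tsum_comp_le_tsum_of_injective
    (f := fun t : {t : ValueState S | t.1.2 = σ} => t.1.1.1) ?_ (fun V => denote S M V * f V)
  rintro ⟨⟨⟨V, _⟩, _⟩, hV⟩ ⟨⟨⟨W, _⟩, _⟩, hW⟩ e
  simp only [Set.mem_ofPred_eq] at hV hW e
  subst hV; subst hW; subst e; rfl

/-- Only closed values of type `σ` occur as targets; the support condition on `f` ensures that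
nothing is lost by restricting to them, without appeal to type preservation. -/
theorem le_tsum_eval {σ : Ty} {M : Tm S.Op} (hM : HasType S [] M σ) {f : Tm S.Op → ℝ≥0∞}
    (hf : ∀ V, f V ≠ 0 → IsValue V ∧ HasType S [] V σ) {F : State S → ℝ≥0∞}
    (hF : ∀ v : ValueState S, v.1.2 = σ → f v.1.1 ≤ F (.inr v)) :
    ∑' V, denote S M V * f V ≤ ∑' t, transProb S (.inl ⟨(M, σ), hM⟩) .eval t * F t := by
  have h : Function.support (fun V => denote S M V * f V) ⊆
      {V | IsValue V ∧ HasType S [] V σ} := fun V hV => hf V (right_ne_zero_of_mul hV)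
  rw [← tsum_subtype_eq_of_support_subset h]
  refine le_trans (ENNReal.tsum_le_tsum fun V => ?_) (ENNReal.tsum_comp_le_tsum_of_injective
    (f := fun V : {V | IsValue V ∧ HasType S [] V σ} =>
      (Sum.inr ⟨(V.1, σ), V.2⟩ : State S)) ?_ _)
  · simp only [transProb, if_true]
    exact mul_le_mul' le_rfl (hF ⟨(V.1, σ), V.2⟩ rfl)
  · rintro ⟨V, hV⟩ ⟨W, hW⟩ h
    simpa using h

/-- Similar programs: comparison of expectations over the value distributions. -/
theorem ClosedSim.tsum_le {σ : Ty} {M N : Tm S.Op} (h : ClosedSim S σ M N)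
    {f g : Tm S.Op → ℝ≥0∞} (hf : ∀ V, f V ≠ 0 → IsValue V ∧ HasType S [] V σ)
    (hfg : ∀ V W, ValueSim S σ V W → f V ≤ g W) :
    ∑' V, denote S M V * f V ≤ ∑' W, denote S N W * g W := by
  classical
  obtain ⟨hM, hN, h⟩ := h
  -- The defaults `0` on the left and `⊤` on the right make the comparison trivial at states that
  -- are not distinguished values of type `σ`. They are harmless, since `eval` gives such states
  -- probability `0`.
  let F : State S → ℝ≥0∞ := Sum.elim (fun _ => 0) fun v => if v.1.2 = σ then f v.1.1 else 0
  let G : State S → ℝ≥0∞ := Sum.elim (fun _ => ⊤) fun v => if v.1.2 = σ then g v.1.1 else ⊤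
  refine (le_tsum_eval hM hf (F := F) fun v hv => by simp [F, hv]).trans
    (le_trans ?_ (tsum_eval_le hN (F := G) fun v hv => by simp [G, hv]))
  refine LMC.tsum_mul_le_of_prob_le (C := chain S) (R := (chain S).Similar)
    (h.prob_le .eval) fun x y hxy => ?_
  rcases x with x | ⟨⟨V, τ⟩, hV⟩
  · exact zero_le
  rcases y with y | ⟨⟨W, τ'⟩, hW⟩
  · exact le_top
  by_cases hτ : τ = σ
  · by_cases hτ' : τ' = σ
    · subst hτ; subst hτ'
      simp only [F, G, Sum.elim_inr, if_true]
      exact hfg V W ⟨hV, hW, hxy⟩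
    · simp [G, hτ']
  · simp [F, hτ]

end Chain

/-! ### Howe's lifting of the simulation preorder -/

section Howe

variable {S : Signature}

theorem IsClosure.subst_typed {Γ : List Ty} {ξ : ℕ → Tm S.Op} (h : IsClosure S Γ ξ)
    {M : Tm S.Op} {σ : Ty} (hM : HasType S Γ M σ) : HasType S [] (M.subst ξ) σ :=
  hM.subst fun i τ hi => (h i τ hi).2

theorem simPreorder_refl {Γ : List Ty} {σ : Ty} {M : Tm S.Op} (h : HasType S Γ M σ) :
    (simPreorder S).rel Γ σ M M :=
  ⟨h, h, fun _ hξ => .refl (hξ.subst_typed h)⟩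

theorem simPreorder_trans : (simPreorder S).IsTransitive :=
  fun _ _ _ _ _ h h' => ⟨h.1, h'.2.1, fun ξ hξ => (h.2.2 ξ hξ).trans (h'.2.2 ξ hξ)⟩

theorem simPreorder_closed {σ : Ty} {M N : Tm S.Op} :
    (simPreorder S).rel [] σ M N ↔ ClosedSim S σ M N := by
  constructor
  · rintro ⟨hM, hN, h⟩
    have := h Tm.var fun i τ hi => by simp at hi
    rwa [Tm.subst_var, Tm.subst_var] at this
  · intro h
    have hM := h.1
    have hN := h.2.1
    refine ⟨hM, hN, fun ξ _ => ?_⟩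
    rwa [hM.subst_closed, hN.subst_closed]

theorem simPreorder_rename {Γ Δ : List Ty} {σ : Ty} {M N : Tm S.Op}
    (h : (simPreorder S).rel Γ σ M N) {ρ : ℕ → ℕ}
    (hρ : ∀ i τ, Γ[i]? = some τ → Δ[ρ i]? = some τ) :
    (simPreorder S).rel Δ σ (M.rename ρ) (N.rename ρ) := by
  refine ⟨h.1.rename hρ, h.2.1.rename hρ, fun ξ hξ => ?_⟩
  rw [Tm.subst_rename, Tm.subst_rename]
  exact h.2.2 _ fun i τ hi => hξ _ τ (hρ i τ hi)

/-- Substitutions of terms over `Δ` for the variables of `Γ` that become values of the right types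
under every closure. -/
def IsValueSub (S : Signature) (Γ Δ : List Ty) (θ : ℕ → Tm S.Op) : Prop :=
  (∀ i τ, Γ[i]? = some τ → HasType S Δ (θ i) τ) ∧
    ∀ ξ, IsClosure S Δ ξ → IsClosure S Γ (Tm.subst ξ ∘ θ)

/-- The bound variable is sent to itself, and a variable is not a value. This is why `IsValueSub`
asks for values only after closing. -/
theorem IsValueSub.lift {Γ Δ : List Ty} {θ : ℕ → Tm S.Op} (h : IsValueSub S Γ Δ θ) (α : Ty) :
    IsValueSub S (α :: Γ) (α :: Δ) (liftSub θ) := by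
  refine ⟨fun i τ hi => ?_, fun ξ hξ i τ hi => ?_⟩
  · cases i with
    | zero => exact .var hi
    | succ i => exact (h.1 i τ hi).weaken α
  · cases i with
    | zero => exact hξ 0 τ hi
    | succ i =>
      simp only [Function.comp, liftSub, Tm.subst_rename]
      exact h.2 (ξ ∘ Nat.succ) (fun j τ' hj => hξ (j + 1) τ' hj) i τ hi

theorem IsClosure.isValueSub {Γ : List Ty} {ξ : ℕ → Tm S.Op} (h : IsClosure S Γ ξ) :
    IsValueSub S Γ [] ξ :=
  ⟨fun i τ hi => (h i τ hi).2, fun ζ _ i τ hi =>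
    ⟨(h i τ hi).1.subst ζ, (h i τ hi).2.subst fun _ _ hj => by simp at hj⟩⟩

theorem simPreorder_subst {Γ Δ : List Ty} {σ : Ty} {M N : Tm S.Op}
    (h : (simPreorder S).rel Γ σ M N) {θ : ℕ → Tm S.Op} (hθ : IsValueSub S Γ Δ θ) :
    (simPreorder S).rel Δ σ (M.subst θ) (N.subst θ) := by
  refine ⟨h.1.subst hθ.1, h.2.1.subst hθ.1, fun ξ hξ => ?_⟩
  rw [Tm.subst_subst, Tm.subst_subst]
  exact h.2.2 _ (hθ.2 ξ hξ)

/-- Howe's lifting: compatible closure interleaved with the simulation preorder. -/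
inductive Howe (S : Signature) : List Ty → Ty → Tm S.Op → Tm S.Op → Prop
  | var {Γ : List Ty} {i : ℕ} {σ : Ty} {X : Tm S.Op} :
      Γ[i]? = some σ → (simPreorder S).rel Γ σ (.var i) X → Howe S Γ σ (.var i) X
  | num {Γ : List Ty} {k : ℕ} {X : Tm S.Op} :
      (simPreorder S).rel Γ .int (.num k) X → Howe S Γ .int (.num k) X
  | bool {Γ : List Ty} {b : Bool} {X : Tm S.Op} :
      (simPreorder S).rel Γ .bool (.bool b) X → Howe S Γ .bool (.bool b) X
  | nil {Γ : List Ty} {σ : Ty} {X : Tm S.Op} :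
      (simPreorder S).rel Γ (.list σ) .nil X → Howe S Γ (.list σ) .nil X
  | pair {Γ : List Ty} {σ τ : Ty} {M M' N N' X : Tm S.Op} :
      Howe S Γ σ M M' → Howe S Γ τ N N' →
      (simPreorder S).rel Γ (.prod σ τ) (.pair M' N') X → Howe S Γ (.prod σ τ) (.pair M N) X
  | cons {Γ : List Ty} {σ : Ty} {M M' N N' X : Tm S.Op} :
      Howe S Γ σ M M' → Howe S Γ (.list σ) N N' →
      (simPreorder S).rel Γ (.list σ) (.cons M' N') X → Howe S Γ (.list σ) (.cons M N) X
  | lam {Γ : List Ty} {σ τ : Ty} {M M' X : Tm S.Op} :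
      Howe S (σ :: Γ) τ M M' →
      (simPreorder S).rel Γ (.arr σ τ) (.lam M') X → Howe S Γ (.arr σ τ) (.lam M) X
  | fix {Γ : List Ty} {σ τ : Ty} {M M' X : Tm S.Op} :
      Howe S (.arr σ τ :: Γ) (.arr σ τ) M M' →
      (simPreorder S).rel Γ (.arr σ τ) (.fix M') X → Howe S Γ (.arr σ τ) (.fix M) X
  | choice {Γ : List Ty} {σ : Ty} {M M' N N' X : Tm S.Op} :
      Howe S Γ σ M M' → Howe S Γ σ N N' →
      (simPreorder S).rel Γ σ (.choice M' N') X → Howe S Γ σ (.choice M N) X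
  | ite {Γ : List Ty} {σ : Ty} {L L' M M' N N' X : Tm S.Op} :
      Howe S Γ .bool L L' → Howe S Γ σ M M' → Howe S Γ σ N N' →
      (simPreorder S).rel Γ σ (.ite L' M' N') X → Howe S Γ σ (.ite L M N) X
  | op {Γ : List Ty} {o : S.Op} {M M' N N' X : Tm S.Op} :
      Howe S Γ .int M M' → Howe S Γ .int N N' →
      (simPreorder S).rel Γ (S.sem o).resTy (.op o M' N') X →
      Howe S Γ (S.sem o).resTy (.op o M N) X
  | fst {Γ : List Ty} {σ τ : Ty} {M M' X : Tm S.Op} :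
      Howe S Γ (.prod σ τ) M M' →
      (simPreorder S).rel Γ σ (.fst M') X → Howe S Γ σ (.fst M) X
  | snd {Γ : List Ty} {σ τ : Ty} {M M' X : Tm S.Op} :
      Howe S Γ (.prod σ τ) M M' →
      (simPreorder S).rel Γ τ (.snd M') X → Howe S Γ τ (.snd M) X
  | caseList {Γ : List Ty} {σ τ : Ty} {L L' M M' N N' X : Tm S.Op} :
      Howe S Γ (.list σ) L L' → Howe S Γ τ M M' → Howe S (σ :: .list σ :: Γ) τ N N' →
      (simPreorder S).rel Γ τ (.caseList L' M' N') X → Howe S Γ τ (.caseList L M N) X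
  | app {Γ : List Ty} {σ τ : Ty} {M M' N N' X : Tm S.Op} :
      Howe S Γ (.arr σ τ) M M' → Howe S Γ σ N N' →
      (simPreorder S).rel Γ τ (.app M' N') X → Howe S Γ τ (.app M N) X

theorem Howe.left_typed {Γ : List Ty} {σ : Ty} {M N : Tm S.Op} (h : Howe S Γ σ M N) :
    HasType S Γ M σ := by
  induction h with
  | var h _ => exact .var h
  | num => exact .num _
  | bool => exact .bool _
  | nil => exact .nil
  | pair _ _ _ h₁ h₂ => exact .pair h₁ h₂
  | cons _ _ _ h₁ h₂ => exact .cons h₁ h₂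
  | lam _ _ h => exact .lam h
  | fix _ _ h => exact .fix h
  | choice _ _ _ h₁ h₂ => exact .choice h₁ h₂
  | ite _ _ _ _ h₁ h₂ h₃ => exact .ite h₁ h₂ h₃
  | op _ _ _ h₁ h₂ => exact .op _ h₁ h₂
  | fst _ _ h => exact .fst h
  | snd _ _ h => exact .snd h
  | caseList _ _ _ _ h₁ h₂ h₃ => exact .caseList h₁ h₂ h₃
  | app _ _ _ h₁ h₂ => exact .app h₁ h₂

theorem Howe.right_typed {Γ : List Ty} {σ : Ty} {M N : Tm S.Op} (h : Howe S Γ σ M N) :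
    HasType S Γ N σ := by
  cases h <;> exact (simPreorder S).right_typed (by assumption)

/-- Every rule ends with a similarity step, so only that last step has to be prolonged by
transitivity of similarity. -/
theorem Howe.trans_sim {Γ : List Ty} {σ : Ty} {M N L : Tm S.Op} (h : Howe S Γ σ M N)
    (h' : (simPreorder S).rel Γ σ N L) : Howe S Γ σ M L := by
  cases h with
  | var h e => exact .var h (simPreorder_trans _ _ _ _ _ e h')
  | num e => exact .num (simPreorder_trans _ _ _ _ _ e h')
  | bool e => exact .bool (simPreorder_trans _ _ _ _ _ e h')
  | nil e => exact .nil (simPreorder_trans _ _ _ _ _ e h')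
  | pair h₁ h₂ e => exact .pair h₁ h₂ (simPreorder_trans _ _ _ _ _ e h')
  | cons h₁ h₂ e => exact .cons h₁ h₂ (simPreorder_trans _ _ _ _ _ e h')
  | lam h e => exact .lam h (simPreorder_trans _ _ _ _ _ e h')
  | fix h e => exact .fix h (simPreorder_trans _ _ _ _ _ e h')
  | choice h₁ h₂ e => exact .choice h₁ h₂ (simPreorder_trans _ _ _ _ _ e h')
  | ite h₁ h₂ h₃ e => exact .ite h₁ h₂ h₃ (simPreorder_trans _ _ _ _ _ e h')
  | op h₁ h₂ e => exact .op h₁ h₂ (simPreorder_trans _ _ _ _ _ e h')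
  | fst h e => exact .fst h (simPreorder_trans _ _ _ _ _ e h')
  | snd h e => exact .snd h (simPreorder_trans _ _ _ _ _ e h')
  | caseList h₁ h₂ h₃ e => exact .caseList h₁ h₂ h₃ (simPreorder_trans _ _ _ _ _ e h')
  | app h₁ h₂ e => exact .app h₁ h₂ (simPreorder_trans _ _ _ _ _ e h')

theorem Howe.refl {Γ : List Ty} {σ : Ty} {M : Tm S.Op} (h : HasType S Γ M σ) :
    Howe S Γ σ M M := by
  have r := simPreorder_refl h
  induction h with
  | var h => exact .var h r
  | bool b => exact .bool r
  | num n => exact .num r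
  | ite t₁ t₂ t₃ h₁ h₂ h₃ =>
    exact .ite (h₁ (simPreorder_refl t₁)) (h₂ (simPreorder_refl t₂)) (h₃ (simPreorder_refl t₃)) r
  | op o t₁ t₂ h₁ h₂ => exact .op (h₁ (simPreorder_refl t₁)) (h₂ (simPreorder_refl t₂)) r
  | lam t h => exact .lam (h (simPreorder_refl t)) r
  | choice t₁ t₂ h₁ h₂ => exact .choice (h₁ (simPreorder_refl t₁)) (h₂ (simPreorder_refl t₂)) r
  | app t₁ t₂ h₁ h₂ => exact .app (h₁ (simPreorder_refl t₁)) (h₂ (simPreorder_refl t₂)) r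
  | fix t h => exact .fix (h (simPreorder_refl t)) r
  | pair t₁ t₂ h₁ h₂ => exact .pair (h₁ (simPreorder_refl t₁)) (h₂ (simPreorder_refl t₂)) r
  | fst t h => exact .fst (h (simPreorder_refl t)) r
  | snd t h => exact .snd (h (simPreorder_refl t)) r
  | nil => exact .nil r
  | cons t₁ t₂ h₁ h₂ => exact .cons (h₁ (simPreorder_refl t₁)) (h₂ (simPreorder_refl t₂)) r
  | caseList t₁ t₂ t₃ h₁ h₂ h₃ =>
    exact .caseList (h₁ (simPreorder_refl t₁)) (h₂ (simPreorder_refl t₂))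
      (h₃ (simPreorder_refl t₃)) r

theorem Howe.of_sim {Γ : List Ty} {σ : Ty} {M N : Tm S.Op}
    (h : (simPreorder S).rel Γ σ M N) : Howe S Γ σ M N :=
  (Howe.refl h.1).trans_sim h

/-- Howe's lifting as a typed relation. -/
def howeRel (S : Signature) : TypedRel S where
  rel := Howe S
  left_typed := Howe.left_typed
  right_typed := Howe.right_typed

theorem howeRel_isCompatible (S : Signature) : (howeRel S).IsCompatible where
  var _ _ _ h := .refl (.var h)
  num _ k := .refl (.num k)
  bool _ b := .refl (.bool b)
  nil _ _ := .refl .nil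
  pair _ _ _ _ _ _ _ h₁ h₂ :=
    .pair h₁ h₂ (simPreorder_refl (.pair h₁.right_typed h₂.right_typed))
  cons _ _ _ _ _ _ h₁ h₂ :=
    .cons h₁ h₂ (simPreorder_refl (.cons h₁.right_typed h₂.right_typed))
  lam _ _ _ _ _ h := .lam h (simPreorder_refl (.lam h.right_typed))
  fix _ _ _ _ _ h := .fix h (simPreorder_refl (.fix h.right_typed))
  choice _ _ _ _ _ _ h₁ h₂ :=
    .choice h₁ h₂ (simPreorder_refl (.choice h₁.right_typed h₂.right_typed))
  ite _ _ _ _ _ _ _ _ h₁ h₂ h₃ :=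
    .ite h₁ h₂ h₃ (simPreorder_refl (.ite h₁.right_typed h₂.right_typed h₃.right_typed))
  op _ o _ _ _ _ h₁ h₂ :=
    .op h₁ h₂ (simPreorder_refl (.op o h₁.right_typed h₂.right_typed))
  fst _ _ _ _ _ h := .fst h (simPreorder_refl (.fst h.right_typed))
  snd _ _ _ _ _ h := .snd h (simPreorder_refl (.snd h.right_typed))
  caseList _ _ _ _ _ _ _ _ _ h₁ h₂ h₃ :=
    .caseList h₁ h₂ h₃ (simPreorder_refl (.caseList h₁.right_typed h₂.right_typed h₃.right_typed))
  app _ _ _ _ _ _ _ h₁ h₂ :=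
    .app h₁ h₂ (simPreorder_refl (.app h₁.right_typed h₂.right_typed))

theorem Howe.rename {Γ : List Ty} {σ : Ty} {M N : Tm S.Op} (h : Howe S Γ σ M N) :
    ∀ {Δ : List Ty} {ρ : ℕ → ℕ}, (∀ i τ, Γ[i]? = some τ → Δ[ρ i]? = some τ) →
      Howe S Δ σ (M.rename ρ) (N.rename ρ) := by
  have lift : ∀ {Γ Δ : List Ty} {ρ : ℕ → ℕ} (α : Ty),
      (∀ i τ, Γ[i]? = some τ → Δ[ρ i]? = some τ) →
      ∀ i τ, (α :: Γ)[i]? = some τ → (α :: Δ)[liftRen ρ i]? = some τ := by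
    intro Γ Δ ρ α h i τ hi
    cases i with
    | zero => exact hi
    | succ i => exact h i τ hi
  induction h with
  | var h e => intro Δ ρ hρ; exact .var (hρ _ _ h) (simPreorder_rename e hρ)
  | num e => intro Δ ρ hρ; exact .num (simPreorder_rename e hρ)
  | bool e => intro Δ ρ hρ; exact .bool (simPreorder_rename e hρ)
  | nil e => intro Δ ρ hρ; exact .nil (simPreorder_rename e hρ)
  | pair _ _ e h₁ h₂ => intro Δ ρ hρ; exact .pair (h₁ hρ) (h₂ hρ) (simPreorder_rename e hρ)
  | cons _ _ e h₁ h₂ => intro Δ ρ hρ; exact .cons (h₁ hρ) (h₂ hρ) (simPreorder_rename e hρ)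
  | lam _ e h => intro Δ ρ hρ; exact .lam (h (lift _ hρ)) (simPreorder_rename e hρ)
  | fix _ e h => intro Δ ρ hρ; exact .fix (h (lift _ hρ)) (simPreorder_rename e hρ)
  | choice _ _ e h₁ h₂ => intro Δ ρ hρ; exact .choice (h₁ hρ) (h₂ hρ) (simPreorder_rename e hρ)
  | ite _ _ _ e h₁ h₂ h₃ =>
    intro Δ ρ hρ; exact .ite (h₁ hρ) (h₂ hρ) (h₃ hρ) (simPreorder_rename e hρ)
  | op _ _ e h₁ h₂ => intro Δ ρ hρ; exact .op (h₁ hρ) (h₂ hρ) (simPreorder_rename e hρ)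
  | fst _ e h => intro Δ ρ hρ; exact .fst (h hρ) (simPreorder_rename e hρ)
  | snd _ e h => intro Δ ρ hρ; exact .snd (h hρ) (simPreorder_rename e hρ)
  | caseList _ _ _ e h₁ h₂ h₃ =>
    intro Δ ρ hρ
    exact .caseList (h₁ hρ) (h₂ hρ) (h₃ (lift _ (lift _ hρ))) (simPreorder_rename e hρ)
  | app _ _ e h₁ h₂ => intro Δ ρ hρ; exact .app (h₁ hρ) (h₂ hρ) (simPreorder_rename e hρ)

/-- Howe's lifting is substitutive. -/
theorem Howe.subst {Γ : List Ty} {σ : Ty} {M N : Tm S.Op} (h : Howe S Γ σ M N) :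
    ∀ {Δ : List Ty} {θ θ' : ℕ → Tm S.Op},
      (∀ i τ, Γ[i]? = some τ → Howe S Δ τ (θ i) (θ' i)) → IsValueSub S Γ Δ θ' →
      Howe S Δ σ (M.subst θ) (N.subst θ') := by
  have lift : ∀ {Γ Δ : List Ty} {θ θ' : ℕ → Tm S.Op} (α : Ty),
      (∀ i τ, Γ[i]? = some τ → Howe S Δ τ (θ i) (θ' i)) →
      ∀ i τ, (α :: Γ)[i]? = some τ → Howe S (α :: Δ) τ (liftSub θ i) (liftSub θ' i) := by
    intro Γ Δ θ θ' α h i τ hi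
    cases i with
    | zero => exact .refl (.var hi)
    | succ i => exact (h i τ hi).rename fun _ _ h => h
  induction h with
  -- The substituted terms are related by hypothesis, and the remaining similarity step survives
  -- substitution because `θ'` becomes a closure after closing; the two are joined by right
  -- absorption.
  | var h e => intro Δ θ θ' hθ v; exact (hθ _ _ h).trans_sim (simPreorder_subst e v)
  | num e => intro Δ θ θ' hθ v; exact .num (simPreorder_subst e v)
  | bool e => intro Δ θ θ' hθ v; exact .bool (simPreorder_subst e v)
  | nil e => intro Δ θ θ' hθ v; exact .nil (simPreorder_subst e v)
  | pair _ _ e h₁ h₂ =>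
    intro Δ θ θ' hθ v; exact .pair (h₁ hθ v) (h₂ hθ v) (simPreorder_subst e v)
  | cons _ _ e h₁ h₂ =>
    intro Δ θ θ' hθ v; exact .cons (h₁ hθ v) (h₂ hθ v) (simPreorder_subst e v)
  | lam _ e h =>
    intro Δ θ θ' hθ v; exact .lam (h (lift _ hθ) (v.lift _)) (simPreorder_subst e v)
  | fix _ e h =>
    intro Δ θ θ' hθ v; exact .fix (h (lift _ hθ) (v.lift _)) (simPreorder_subst e v)
  | choice _ _ e h₁ h₂ =>
    intro Δ θ θ' hθ v; exact .choice (h₁ hθ v) (h₂ hθ v) (simPreorder_subst e v)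
  | ite _ _ _ e h₁ h₂ h₃ =>
    intro Δ θ θ' hθ v; exact .ite (h₁ hθ v) (h₂ hθ v) (h₃ hθ v) (simPreorder_subst e v)
  | op _ _ e h₁ h₂ =>
    intro Δ θ θ' hθ v; exact .op (h₁ hθ v) (h₂ hθ v) (simPreorder_subst e v)
  | fst _ e h => intro Δ θ θ' hθ v; exact .fst (h hθ v) (simPreorder_subst e v)
  | snd _ e h => intro Δ θ θ' hθ v; exact .snd (h hθ v) (simPreorder_subst e v)
  | caseList _ _ _ e h₁ h₂ h₃ =>
    intro Δ θ θ' hθ v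
    exact .caseList (h₁ hθ v) (h₂ hθ v) (h₃ (lift _ (lift _ hθ)) ((v.lift _).lift _))
      (simPreorder_subst e v)
  | app _ _ e h₁ h₂ =>
    intro Δ θ θ' hθ v; exact .app (h₁ hθ v) (h₂ hθ v) (simPreorder_subst e v)

/-! ### Inversion of Howe's lifting on closed values. -/

/-- Howe's lifting between closed values. -/
def HoweValue (S : Signature) (σ : Ty) (V W : Tm S.Op) : Prop :=
  IsValue V ∧ IsValue W ∧ Howe S [] σ V W

theorem HoweValue.right {σ : Ty} {V W : Tm S.Op} (h : HoweValue S σ V W) :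
    IsValue W ∧ HasType S [] W σ := ⟨h.2.1, h.2.2.right_typed⟩

theorem HoweValue.refl {σ : Ty} {V : Tm S.Op} (hV : IsValue V) (h : HasType S [] V σ) :
    HoweValue S σ V V := ⟨hV, hV, .refl h⟩

theorem HoweValue.trans_sim {σ : Ty} {V W U : Tm S.Op} (h : HoweValue S σ V W)
    (h' : ValueSim S σ W U) : HoweValue S σ V U :=
  ⟨h.1, h'.2.1.1, h.2.2.trans_sim (simPreorder_closed.2 h'.closedSim)⟩

theorem valueSim_of_rel {σ : Ty} {V W : Tm S.Op} (h : (simPreorder S).rel [] σ V W)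
    (hV : IsValue V) (hW : IsValue W) : ValueSim S σ V W :=
  (simPreorder_closed.1 h).valueSim hV hW

/-- The last rule of the derivation gives an intermediate pair similar to `W`; similarity of values
makes `W` a pair as well, and the component similarities are absorbed on the right. -/
theorem HoweValue.pair {σ₀ : Ty} {P Q W : Tm S.Op} (h : HoweValue S σ₀ (.pair P Q) W) :
    ∃ σ τ P' Q', σ₀ = .prod σ τ ∧ W = .pair P' Q' ∧ Howe S [] σ P P' ∧ Howe S [] τ Q Q' := by
  obtain ⟨_, hW, h⟩ := h
  cases h with
  | pair h₁ h₂ e =>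
    obtain ⟨P', Q', rfl, e₁, e₂⟩ := (valueSim_of_rel e (.pair _ _) hW).pair
    exact ⟨_, _, P', Q', rfl, rfl, h₁.trans_sim (simPreorder_closed.2 e₁),
      h₂.trans_sim (simPreorder_closed.2 e₂)⟩

theorem HoweValue.cons {σ₀ : Ty} {P Q W : Tm S.Op} (h : HoweValue S σ₀ (.cons P Q) W) :
    ∃ σ P' Q', σ₀ = .list σ ∧ W = .cons P' Q' ∧ Howe S [] σ P P' ∧
      Howe S [] (.list σ) Q Q' := by
  obtain ⟨_, hW, h⟩ := h
  cases h with
  | cons h₁ h₂ e =>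
    obtain ⟨P', Q', rfl, e₁, e₂⟩ := (valueSim_of_rel e (.cons _ _) hW).cons
    exact ⟨_, P', Q', rfl, rfl, h₁.trans_sim (simPreorder_closed.2 e₁),
      h₂.trans_sim (simPreorder_closed.2 e₂)⟩

theorem HoweValue.nil {σ : Ty} {W : Tm S.Op} (h : HoweValue S σ .nil W) : W = .nil := by
  obtain ⟨_, hW, h⟩ := h
  cases h with
  | nil e => exact (valueSim_of_rel e .nil hW).nil

theorem HoweValue.num {σ : Ty} {k : ℕ} {W : Tm S.Op} (h : HoweValue S σ (.num k) W) :
    W = .num k := by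
  obtain ⟨_, hW, h⟩ := h
  cases h with
  | num e => exact (valueSim_of_rel e (.num k) hW).num

theorem HoweValue.bool {σ : Ty} {b : Bool} {W : Tm S.Op} (h : HoweValue S σ (.bool b) W) :
    W = .bool b := by
  obtain ⟨_, hW, h⟩ := h
  cases h with
  | bool e => exact (valueSim_of_rel e (.bool b) hW).bool

theorem Howe.inst {σ τ : Ty} {M N V W : Tm S.Op} (h : Howe S [τ] σ M N)
    (hV : HoweValue S τ V W) : Howe S [] σ (M.inst V) (N.inst W) := by
  rw [Tm.inst_eq_subst, Tm.inst_eq_subst]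
  refine h.subst (fun i α hi => ?_) (IsClosure.isValueSub fun i α hi => ?_)
  · cases i with
    | zero => simp at hi; exact hi ▸ hV.2.2
    | succ i => simp at hi
  · cases i with
    | zero => simp at hi; exact hi ▸ hV.right
    | succ i => simp at hi

theorem Howe.inst₂ {σ τ τ' : Ty} {M N V W V' W' : Tm S.Op} (h : Howe S [τ, τ'] σ M N)
    (hV : HoweValue S τ V V') (hW : HoweValue S τ' W W') :
    Howe S [] σ (M.inst₂ V W) (N.inst₂ V' W') := by
  rw [Tm.inst₂_eq_subst, Tm.inst₂_eq_subst]
  refine h.subst (fun i α hi => ?_) (IsClosure.isValueSub fun i α hi => ?_)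
  · rcases i with _ | _ | i
    · simp at hi; exact hi ▸ hV.2.2
    · simp at hi; exact hi ▸ hW.2.2
    · simp at hi
  · rcases i with _ | _ | i
    · simp at hi; exact hi ▸ hV.right
    · simp at hi; exact hi ▸ hW.right
    · simp at hi

/-- The argument is changed from `U` to `U'` while passing from `V` to an intermediate function
`V₁`, where substitutivity applies. Similarity then moves from `V₁` to `W` at the common argument
`U'`. -/
theorem HoweValue.apply {τ θ : Ty} {V W U U' B : Tm S.Op} (h : HoweValue S (.arr τ θ) V W)
    (hU : HoweValue S τ U U') (hB : applyVal V U = some B) :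
    ∃ B', applyVal W U' = some B' ∧ Howe S [] θ B B' := by
  obtain ⟨V₁, B₁, e, hB₁, h₁⟩ : ∃ V₁ B₁, ValueSim S (.arr τ θ) V₁ W ∧
      applyVal V₁ U' = some B₁ ∧ Howe S [] θ B B₁ := by
    obtain ⟨_, hW, h⟩ := h
    generalize hα : Ty.arr τ θ = α at h ⊢
    cases V <;> simp only [applyVal, Option.some.injEq, reduceCtorEq] at hB
    case lam P =>
      subst hB
      cases h with
      | lam h e =>
        cases hα
        exact ⟨_, _, valueSim_of_rel e (.lam _) hW, rfl, h.inst hU⟩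
    case fix Q =>
      subst hB
      cases h with
      | fix h e =>
        cases hα
        refine ⟨_, _, valueSim_of_rel e (.fix _) hW, rfl, ?_⟩
        -- The recursive occurrence is replaced by the two fixed points themselves, which are
        -- related by compatibility.
        refine (howeRel_isCompatible S).app _ τ θ _ _ _ _ (h.inst ?_) hU.2.2
        exact ⟨.fix _, .fix _, (howeRel_isCompatible S).fix _ _ _ _ _ h⟩
  obtain ⟨B', hB', e'⟩ := e.apply hU.2.1 hU.right.2 hB₁
  exact ⟨B', hB', h₁.trans_sim (simPreorder_closed.2 e')⟩

end Howe

/-! ### Expectations of test functions -/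

section Expectation

variable {S : Signature}

/-- Extension by `0` off the given shape turns the partial sums in `stepDist` into expectations over
all terms, the form in which domination can be used. The next three definitions serve the same
purpose. -/
def onNum {Op : Type} (h : ℕ → ℝ≥0∞) : Tm Op → ℝ≥0∞
  | .num i => h i
  | _ => 0

def onBool {Op : Type} (h : Bool → ℝ≥0∞) : Tm Op → ℝ≥0∞
  | .bool b => h b
  | _ => 0

def onPair {Op : Type} (h : Tm Op → Tm Op → ℝ≥0∞) : Tm Op → ℝ≥0∞
  | .pair P Q => h P Q
  | _ => 0

def onList {Op : Type} (a : ℝ≥0∞) (h : Tm Op → Tm Op → ℝ≥0∞) : Tm Op → ℝ≥0∞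
  | .nil => a
  | .cons H T => h H T
  | _ => 0

/-- The test function on functional values that applies them to `U`. -/
def onApply {Op : Type} (h : Tm Op → ℝ≥0∞) (U V : Tm Op) : ℝ≥0∞ :=
  (applyVal V U).elim 0 h

theorem tsum_mul_comp {α β : Type} {c : α → β} (hc : Function.Injective c) (D : β → ℝ≥0∞)
    {k : β → ℝ≥0∞} (hk : ∀ b, k b ≠ 0 → b ∈ Set.range c) :
    ∑' a, D (c a) * k (c a) = ∑' b, D b * k b :=
  hc.tsum_eq (f := fun b => D b * k b) fun b hb => hk b (right_ne_zero_of_mul hb)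

theorem tsum_mul_comp₂ {α β γ : Type} {c : α → β → γ} (hc : Function.Injective2 c)
    (D : γ → ℝ≥0∞) {k : γ → ℝ≥0∞} (hk : ∀ x, k x ≠ 0 → ∃ a b, c a b = x) :
    ∑' a, ∑' b, D (c a b) * k (c a b) = ∑' x, D x * k x := by
  rw [← tsum_mul_comp (c := fun p : α × β => c p.1 p.2) (D := D) (k := k)
    (fun p q h => Prod.ext (hc h).1 (hc h).2) (fun x hx => by
      obtain ⟨a, b, rfl⟩ := hk x hx
      exact ⟨(a, b), rfl⟩)]
  exact (ENNReal.tsum_prod (f := fun a b => D (c a b) * k (c a b))).symm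

theorem tsum_onNum {Op : Type} (D : Tm Op → ℝ≥0∞) (h : ℕ → ℝ≥0∞) :
    ∑' V, D V * onNum h V = ∑' i, D (.num i) * h i :=
  (tsum_mul_comp (c := Tm.num) (fun _ _ h => by injection h) D fun V hV => by
    cases V <;> first | exact ⟨_, rfl⟩ | exact absurd rfl hV).symm

theorem tsum_onBool {Op : Type} (D : Tm Op → ℝ≥0∞) (h : Bool → ℝ≥0∞) :
    ∑' V, D V * onBool h V = D (.bool true) * h true + D (.bool false) * h false := by
  rw [← tsum_mul_comp (c := Tm.bool) (fun _ _ h => by injection h) D fun V hV => by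
    cases V <;> first | exact ⟨_, rfl⟩ | exact absurd rfl hV, tsum_fintype, Fintype.sum_bool]
  rfl

theorem tsum_onPair {Op : Type} (D : Tm Op → ℝ≥0∞) (h : Tm Op → Tm Op → ℝ≥0∞) :
    ∑' V, D V * onPair h V = ∑' P, ∑' Q, D (.pair P Q) * h P Q :=
  (tsum_mul_comp₂ (c := Tm.pair) (fun _ _ _ _ h => by injection h with h₁ h₂; exact ⟨h₁, h₂⟩) D
    fun V hV => by
      cases V <;> first | exact ⟨_, _, rfl⟩ | exact absurd rfl hV).symm

theorem tsum_onList {Op : Type} (D : Tm Op → ℝ≥0∞) (a : ℝ≥0∞) (h : Tm Op → Tm Op → ℝ≥0∞) :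
    ∑' V, D V * onList a h V = D .nil * a + ∑' H, ∑' T, D (.cons H T) * h H T := by
  have e : ∀ V : Tm Op, D V * onList a h V =
      D V * onList a (fun _ _ => 0) V + D V * onList 0 h V := by
    intro V
    cases V <;> simp [onList]
  rw [tsum_congr e, ENNReal.tsum_add]
  congr 1
  · rw [tsum_eq_single Tm.nil]
    · rfl
    · intro V hV
      cases V <;> simp [onList] at hV ⊢
  · exact (tsum_mul_comp₂ (c := Tm.cons)
      (fun _ _ _ _ h => by injection h with h₁ h₂; exact ⟨h₁, h₂⟩) D fun V hV => by
        cases V <;> first | exact ⟨_, _, rfl⟩ | exact absurd rfl hV).symm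

/-- The test function is split into its parts on abstractions and on fixed points, and each part is
reindexed along an injective constructor. -/
theorem tsum_onApply {Op : Type} (D : Tm Op → ℝ≥0∞) (h : Tm Op → ℝ≥0∞) (U : Tm Op) :
    ∑' V, D V * onApply h U V = (∑' P, D (.lam P) * h (P.inst U)) +
      ∑' Q, D (.fix Q) * h (.app (Q.inst (.fix Q)) U) := by
  classical
  let k₁ : Tm Op → ℝ≥0∞ := fun V => if V ∈ Set.range Tm.lam then onApply h U V else 0
  let k₂ : Tm Op → ℝ≥0∞ := fun V => if V ∈ Set.range Tm.fix then onApply h U V else 0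
  have e : ∀ V : Tm Op, D V * onApply h U V = D V * k₁ V + D V * k₂ V := by
    intro V
    cases V <;> simp [k₁, k₂, onApply, applyVal]
  rw [tsum_congr e, ENNReal.tsum_add,
    ← tsum_mul_comp (c := Tm.lam) (fun _ _ h => by injection h) D (k := k₁)
      (fun V hV => by by_contra hc; exact hV (if_neg hc)),
    ← tsum_mul_comp (c := Tm.fix) (fun _ _ h => by injection h) D (k := k₂)
      (fun V hV => by by_contra hc; exact hV (if_neg hc))]
  simp [k₁, k₂, onApply, applyVal]

/-! ### Expectations over results as nested expectations over subcomputations. -/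

/-- The expectation of `f` over the value distribution `A (M, ·)`. -/
noncomputable def expect (A : Tm S.Op × Tm S.Op → ℝ≥0∞) (M : Tm S.Op) (f : Tm S.Op → ℝ≥0∞) :
    ℝ≥0∞ := ∑' X, A (M, X) * f X

theorem tsum_tsum_mul {α β : Type} (a : α → ℝ≥0∞) (b : α → β → ℝ≥0∞) (f : β → ℝ≥0∞) :
    ∑' x, (∑' i, a i * b i x) * f x = ∑' i, a i * ∑' x, b i x * f x := by
  simp_rw [← ENNReal.tsum_mul_right, ← ENNReal.tsum_mul_left, mul_assoc]
  exact ENNReal.tsum_comm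

theorem tsum_dirac_mul {Op : Type} (V : Tm Op) (f : Tm Op → ℝ≥0∞) :
    ∑' X, dirac V X * f X = f V := by
  rw [tsum_eq_single V]
  · simp [dirac]
  · intro X hX
    simp [dirac, hX]

variable (A : Tm S.Op × Tm S.Op → ℝ≥0∞) (f : Tm S.Op → ℝ≥0∞)

/-- Integrating out the result leaves one expectation per premise. In this nested form of the rule,
and of those below, every inner expectation is a test function for the outer one. -/
theorem tsum_stepDist_op (o : S.Op) (M N : Tm S.Op) :
    ∑' X, stepDist S A (.op o M N) X * f X =
      expect A M (onNum fun i => expect A N (onNum fun j => f ((S.sem o).result i j))) := by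
  simp only [expect, tsum_onNum, stepDist, mul_assoc, ENNReal.tsum_mul_left]
  rw [tsum_tsum_mul]
  refine tsum_congr fun i => ?_
  rw [tsum_tsum_mul]
  simp_rw [tsum_dirac_mul]

theorem tsum_stepDist_app (M N : Tm S.Op) :
    ∑' X, stepDist S A (.app M N) X * f X =
      expect A N fun U => expect A M (onApply (fun B => expect A B f) U) := by
  simp only [expect, stepDist, tsum_onApply]
  rw [tsum_tsum_mul]
  refine tsum_congr fun U => ?_
  simp_rw [add_mul]
  rw [ENNReal.tsum_add, tsum_tsum_mul, tsum_tsum_mul]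

theorem tsum_stepDist_ite (L M N : Tm S.Op) :
    ∑' X, stepDist S A (.ite L M N) X * f X =
      expect A L (onBool fun b => bif b then expect A M f else expect A N f) := by
  simp only [expect, stepDist, tsum_onBool, add_mul, mul_assoc, ENNReal.tsum_add,
    ENNReal.tsum_mul_left, cond_true, cond_false]

theorem tsum_stepDist_caseList (L M N : Tm S.Op) :
    ∑' X, stepDist S A (.caseList L M N) X * f X =
      expect A L (onList (expect A M f) fun H T =>
        expect A H fun V => expect A T fun W => expect A (N.inst₂ V W) f) := by
  simp only [expect, stepDist, tsum_onList, add_mul, ENNReal.tsum_add]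
  congr 1
  · simp only [mul_assoc, ENNReal.tsum_mul_left]
  · simp only [mul_assoc, ENNReal.tsum_mul_left]
    simp_rw [← ENNReal.tsum_mul_right]
    rw [ENNReal.tsum_comm]
    refine tsum_congr fun H => ?_
    rw [ENNReal.tsum_comm]
    refine tsum_congr fun T => ?_
    simp_rw [mul_assoc]
    rw [ENNReal.tsum_mul_left, tsum_tsum_mul]
    simp_rw [tsum_tsum_mul]

theorem tsum_stepDist_fst (M : Tm S.Op) :
    ∑' X, stepDist S A (.fst M) X * f X = expect A M (onPair fun P _ => expect A P f) := by
  simp only [expect, stepDist, tsum_onPair]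
  simp_rw [← ENNReal.tsum_mul_right]
  rw [ENNReal.tsum_comm]
  refine tsum_congr fun P => ?_
  rw [ENNReal.tsum_comm]
  simp_rw [mul_assoc, ENNReal.tsum_mul_left]

theorem tsum_stepDist_snd (M : Tm S.Op) :
    ∑' X, stepDist S A (.snd M) X * f X = expect A M (onPair fun _ Q => expect A Q f) := by
  simp only [expect, stepDist, tsum_onPair]
  simp_rw [← ENNReal.tsum_mul_right]
  rw [ENNReal.tsum_comm]
  refine tsum_congr fun P => ?_
  rw [ENNReal.tsum_comm]
  simp_rw [mul_assoc, ENNReal.tsum_mul_left]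

theorem tsum_stepDist_choice (M N : Tm S.Op) :
    ∑' X, stepDist S A (.choice M N) X * f X = 2⁻¹ * expect A M f + 2⁻¹ * expect A N f := by
  simp only [expect, stepDist, add_mul, mul_assoc, ENNReal.tsum_add, ENNReal.tsum_mul_left]

end Expectation

/-! ### The key lemma -/

section Key

variable {S : Signature}

/-- The value distribution `D` is dominated by `E` along Howe's lifting on values of type `σ`. -/
def Dominated (S : Signature) (σ : Ty) (D E : Tm S.Op → ℝ≥0∞) : Prop :=
  ∀ f g : Tm S.Op → ℝ≥0∞, (∀ V W, HoweValue S σ V W → f V ≤ g W) →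
    ∑' V, D V * f V ≤ ∑' W, E W * g W

/-- Domination along Howe's lifting followed by similarity is handled by interpolating a test
function between `f` and `g`. -/
theorem Dominated.trans_sim {σ : Ty} {D : Tm S.Op → ℝ≥0∞} {M N : Tm S.Op}
    (h : Dominated S σ D (denote S M)) (h' : (simPreorder S).rel [] σ M N) :
    Dominated S σ D (denote S N) := by
  intro f g hfg
  -- This is the least function lying above `f` along Howe's lifting; it lies below `g` along
  -- similarity because the lifting absorbs similarity.
  let f' : Tm S.Op → ℝ≥0∞ := fun U => ⨆ V, ⨆ _ : HoweValue S σ V U, f V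
  refine (h f f' fun V W hVW => le_iSup₂_of_le V hVW le_rfl).trans
    ((simPreorder_closed.1 h').tsum_le (fun U hU => ?_) fun U W hUW =>
      iSup₂_le fun V hVU => hfg V W (hVU.trans_sim hUW))
  -- Off the closed values of type `σ` the supremum is empty, hence `0`, as `ClosedSim.tsum_le`
  -- requires.
  by_contra hc
  refine hU ?_
  exact le_antisymm (iSup₂_le fun V hV => absurd (HoweValue.right hV) hc) zero_le

theorem dominated_value {σ : Ty} {V V' : Tm S.Op} (A : Tm S.Op × Tm S.Op → ℝ≥0∞)
    (h : HoweValue S σ V V') : Dominated S σ (stepDist S A V) (denote S V') := by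
  intro f g hfg
  rw [denote_value h.2.1, stepDist_value h.1, tsum_dirac_mul, tsum_dirac_mul]
  exact hfg _ _ h

/-- The big-step semantics as a function of pairs. -/
noncomputable def denotePair (S : Signature) (p : Tm S.Op × Tm S.Op) : ℝ≥0∞ := denote S p.1 p.2

/-- In the key lemma the left program is already one unfolding of an approximation. The fixed-point
equation provides a matching unfolding of the right program. -/
theorem tsum_denote_eq (M : Tm S.Op) (f : Tm S.Op → ℝ≥0∞) :
    ∑' X, denote S M X * f X = ∑' X, stepDist S (denotePair S) M X * f X := by
  rw [← stepDist_denote M]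
  rfl

/-- Test functions by shape are monotone along Howe's lifting because related values share the shape
and have related components. This and its analogues below pass the comparison from an inner to an
outer expectation. -/
theorem HoweValue.onNum_le {σ : Ty} {h k : ℕ → ℝ≥0∞} (hhk : ∀ i, h i ≤ k i) (V W : Tm S.Op)
    (hVW : HoweValue S σ V W) : onNum h V ≤ onNum k W := by
  cases V <;> try exact zero_le
  obtain rfl := hVW.num
  exact hhk _

theorem HoweValue.onBool_le {σ : Ty} {h k : Bool → ℝ≥0∞} (hhk : ∀ i, h i ≤ k i) (V W : Tm S.Op)
    (hVW : HoweValue S σ V W) : onBool h V ≤ onBool k W := by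
  cases V <;> try exact zero_le
  obtain rfl := hVW.bool
  exact hhk _

theorem HoweValue.onPair_le {σ τ : Ty} {h k : Tm S.Op → Tm S.Op → ℝ≥0∞}
    (hhk : ∀ P Q P' Q', Howe S [] σ P P' → Howe S [] τ Q Q' → h P Q ≤ k P' Q') (V W : Tm S.Op)
    (hVW : HoweValue S (.prod σ τ) V W) : onPair h V ≤ onPair k W := by
  cases V <;> try exact zero_le
  obtain ⟨_, _, P', Q', e, rfl, h₁, h₂⟩ := hVW.pair
  cases e
  exact hhk _ _ _ _ h₁ h₂

theorem HoweValue.onList_le {σ : Ty} {a b : ℝ≥0∞} {h k : Tm S.Op → Tm S.Op → ℝ≥0∞} (hab : a ≤ b)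
    (hhk : ∀ P Q P' Q', Howe S [] σ P P' → Howe S [] (.list σ) Q Q' → h P Q ≤ k P' Q')
    (V W : Tm S.Op) (hVW : HoweValue S (.list σ) V W) : onList a h V ≤ onList b k W := by
  cases V <;> try exact zero_le
  · obtain rfl := hVW.nil
    exact hab
  · obtain ⟨_, P', Q', e, rfl, h₁, h₂⟩ := hVW.cons
    cases e
    exact hhk _ _ _ _ h₁ h₂

theorem HoweValue.onApply_le {τ θ : Ty} {h k : Tm S.Op → ℝ≥0∞}
    (hhk : ∀ B B', Howe S [] θ B B' → h B ≤ k B') {U U' : Tm S.Op} (hU : HoweValue S τ U U')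
    (V W : Tm S.Op) (hVW : HoweValue S (.arr τ θ) V W) : onApply h U V ≤ onApply k U' W := by
  unfold onApply
  cases hB : applyVal V U with
  | none => exact zero_le
  | some B =>
    obtain ⟨B', hB', hH⟩ := hVW.apply hU hB
    rw [hB']
    exact hhk _ _ hH

theorem OpSem.result_isValue {Op : Type} (s : OpSem) (i j : ℕ) :
    IsValue (s.result i j : Tm Op) := by
  cases s <;> constructor

theorem OpSem.result_typed (s : OpSem) (i j : ℕ) : HasType S [] (s.result i j) s.resTy := by
  cases s <;> constructor

/-- This is the induction step of the key lemma. Dropping the final similarity step leaves two terms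
with the same outermost constructor and related parts, whose nested expectations are compared layer
by layer. As `f` is unconstrained off closed values of type `σ`, domination also contains type
preservation for the left program. -/
theorem dominated_stepDist {A : Tm S.Op × Tm S.Op → ℝ≥0∞}
    (ih : ∀ σ M N, Howe S [] σ M N → Dominated S σ (fun X => A (M, X)) (denote S N))
    {σ : Ty} {M N : Tm S.Op} (h : Howe S [] σ M N) :
    Dominated S σ (stepDist S A M) (denote S N) := by
  have ih' : ∀ {σ M N}, Howe S [] σ M N → ∀ {f g : Tm S.Op → ℝ≥0∞},
      (∀ V W, HoweValue S σ V W → f V ≤ g W) → expect A M f ≤ expect (denotePair S) N g :=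
    fun h f g hfg => ih _ _ _ h f g hfg
  generalize hΓ : ([] : List Ty) = Γ at h
  cases h with
  | var h => subst hΓ; simp at h
  | num e =>
    subst hΓ
    exact (dominated_value A (.refl (.num _) e.1)).trans_sim e
  | bool e =>
    subst hΓ
    exact (dominated_value A (.refl (.bool _) e.1)).trans_sim e
  | nil e =>
    subst hΓ
    exact (dominated_value A (.refl .nil e.1)).trans_sim e
  | pair h₁ h₂ e =>
    subst hΓ
    exact (dominated_value A ⟨.pair _ _, .pair _ _,
      (howeRel_isCompatible S).pair _ _ _ _ _ _ _ h₁ h₂⟩).trans_sim e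
  | cons h₁ h₂ e =>
    subst hΓ
    exact (dominated_value A ⟨.cons _ _, .cons _ _,
      (howeRel_isCompatible S).cons _ _ _ _ _ _ h₁ h₂⟩).trans_sim e
  | lam h e =>
    subst hΓ
    exact (dominated_value A ⟨.lam _, .lam _,
      (howeRel_isCompatible S).lam _ _ _ _ _ h⟩).trans_sim e
  | fix h e =>
    subst hΓ
    exact (dominated_value A ⟨.fix _, .fix _,
      (howeRel_isCompatible S).fix _ _ _ _ _ h⟩).trans_sim e
  | choice h₁ h₂ e =>
    subst hΓ
    refine Dominated.trans_sim (fun f g hfg => ?_) e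
    rw [tsum_denote_eq, tsum_stepDist_choice, tsum_stepDist_choice]
    exact add_le_add (mul_le_mul' le_rfl (ih' h₁ hfg)) (mul_le_mul' le_rfl (ih' h₂ hfg))
  | ite h₁ h₂ h₃ e =>
    subst hΓ
    refine Dominated.trans_sim (fun f g hfg => ?_) e
    rw [tsum_denote_eq, tsum_stepDist_ite, tsum_stepDist_ite]
    refine ih' h₁ (HoweValue.onBool_le fun b => ?_)
    cases b
    · exact ih' h₃ hfg
    · exact ih' h₂ hfg
  | @op _ o _ _ _ _ _ h₁ h₂ e =>
    subst hΓ
    refine Dominated.trans_sim (fun f g hfg => ?_) e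
    rw [tsum_denote_eq, tsum_stepDist_op, tsum_stepDist_op]
    exact ih' h₁ (HoweValue.onNum_le fun i => ih' h₂ (HoweValue.onNum_le fun j =>
      hfg _ _ (.refl ((S.sem o).result_isValue i j) ((S.sem o).result_typed i j))))
  | fst h e =>
    subst hΓ
    refine Dominated.trans_sim (fun f g hfg => ?_) e
    rw [tsum_denote_eq, tsum_stepDist_fst, tsum_stepDist_fst]
    exact ih' h (HoweValue.onPair_le fun _ _ _ _ h₁ _ => ih' h₁ hfg)
  | snd h e =>
    subst hΓ
    refine Dominated.trans_sim (fun f g hfg => ?_) e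
    rw [tsum_denote_eq, tsum_stepDist_snd, tsum_stepDist_snd]
    exact ih' h (HoweValue.onPair_le fun _ _ _ _ _ h₂ => ih' h₂ hfg)
  | caseList h₁ h₂ h₃ e =>
    subst hΓ
    refine Dominated.trans_sim (fun f g hfg => ?_) e
    rw [tsum_denote_eq, tsum_stepDist_caseList, tsum_stepDist_caseList]
    exact ih' h₁ (HoweValue.onList_le (ih' h₂ hfg) fun _ _ _ _ hH hT =>
      ih' hH fun _ _ hV => ih' hT fun _ _ hW => ih' (h₃.inst₂ hV hW) hfg)
  | app h₁ h₂ e =>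
    subst hΓ
    refine Dominated.trans_sim (fun f g hfg => ?_) e
    rw [tsum_denote_eq, tsum_stepDist_app, tsum_stepDist_app]
    -- The argument is the outer layer, so a related pair of arguments is available when the
    -- functions are compared.
    exact ih' h₂ fun _ _ hU => ih' h₁ (HoweValue.onApply_le (fun _ _ hB => ih' hB hfg) hU)

theorem dominated_approx (n : ℕ) : ∀ (σ : Ty) (M N : Tm S.Op), Howe S [] σ M N →
    Dominated S σ (fun X => approx S n (M, X)) (denote S N) := by
  induction n with
  | zero =>
    intro σ M N _ f g _
    simp [approx]
  | succ n ih => exact fun σ M N h => dominated_stepDist ih h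

/-- Key lemma: Howe's lifting of similarity is respected by the big-step semantics. -/
theorem Howe.dominated {σ : Ty} {M N : Tm S.Op} (h : Howe S [] σ M N) :
    Dominated S σ (denote S M) (denote S N) := by
  intro f g hfg
  have e : ∀ V, denote S M V * f V = ⨆ n, approx S n (M, V) * f V := fun V => by
    rw [denote_eq_iSup_approx, iSup_apply, ENNReal.iSup_mul]
  rw [tsum_congr e, tsum_iSup_of_monotone (f := fun n V => approx S n (M, V) * f V)
    fun m n h V => mul_le_mul' (approx_mono h _) le_rfl]
  exact iSup_le fun n => dominated_approx n σ M N h f g hfg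

end Key

/-! ### Howe's lifting coincides with the simulation preorder -/

section Main

variable {S : Signature}

/-- Howe's lifting on the states of the chain. -/
def HoweState (S : Signature) : State S → State S → Prop
  | .inl M, .inl N => M.1.2 = N.1.2 ∧ Howe S [] M.1.2 M.1.1 N.1.1
  | .inr V, .inr W => V.1.2 = W.1.2 ∧ HoweValue S V.1.2 V.1.1 W.1.1
  | _, _ => False

/-- The key lemma is applied to the indicators of `X` and of its image, read as functions on terms.
-/
theorem HoweState.prob_eval_le {σ : Ty} {M N : Tm S.Op} (hM : HasType S [] M σ)
    (hN : HasType S [] N σ) (h : Howe S [] σ M N) (X : Set (State S)) :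
    (chain S).prob (.inl ⟨(M, σ), hM⟩) .eval X ≤
      (chain S).prob (.inl ⟨(N, σ), hN⟩) .eval {y | ∃ x ∈ X, HoweState S x y} := by
  classical
  have e : ∀ (L : Tm S.Op) (hL : HasType S [] L σ) (Y : Set (State S)),
      (chain S).prob (.inl ⟨(L, σ), hL⟩) .eval Y =
        ∑' t, transProb S (.inl ⟨(L, σ), hL⟩) .eval t * Y.indicator 1 t := by
    intro L hL Y
    rw [LMC.prob, tsum_subtype]
    refine tsum_congr fun t => ?_
    by_cases ht : t ∈ Y <;> simp [ht]
  let f : Set (State S) → Tm S.Op → ℝ≥0∞ := fun Y V =>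
    if h : IsValue V ∧ HasType S [] V σ then Y.indicator 1 (.inr ⟨(V, σ), h⟩) else 0
  have hf : ∀ (Y : Set (State S)) (v : ValueState S), v.1.2 = σ →
      f Y v.1.1 = Y.indicator 1 (.inr v) := by
    rintro Y ⟨⟨V, τ⟩, hV⟩ rfl
    exact dif_pos hV
  rw [e, e]
  refine (tsum_eval_le hM (f := f X) fun v hv => (hf X v hv).ge).trans
    ((h.dominated (f X) (f {y | ∃ x ∈ X, HoweState S x y}) fun V W hVW => ?_).trans
      (le_tsum_eval hN (fun V hV => ?_) fun v hv => (hf _ v hv).le))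
  · by_cases hV : IsValue V ∧ HasType S [] V σ
    · simp only [f, dif_pos hV, dif_pos hVW.right]
      by_cases hX : (.inr ⟨(V, σ), hV⟩ : State S) ∈ X
      · rw [Set.indicator_of_mem hX, Set.indicator_of_mem]
        · exact le_rfl
        · exact ⟨_, hX, rfl, hVW⟩
      · rw [Set.indicator_of_notMem hX]
        exact zero_le
    · simp only [f, dif_neg hV]
      exact zero_le
  · by_contra hc
    exact hV (dif_neg hc)

/-- Inversion on values provides the matching transition; for application both sides take the same
argument, related to itself by reflexivity. -/
theorem HoweState.detStep {s t s' : State S} {l : Label S} (h : HoweState S s t)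
    (hs : DetStep S s l s') : ∃ t', DetStep S t l t' ∧ HoweState S s' t' := by
  rcases t with ⟨⟨N, τ'⟩, hN⟩ | ⟨⟨W, τ'⟩, hW⟩
  · cases hs with
    | tyTerm =>
      obtain ⟨e, h⟩ := h
      cases e
      exact ⟨_, .tyTerm hN, rfl, h⟩
    | _ => exact h.elim
  · cases hs with
    | tyTerm => exact h.elim
    | tyValue =>
      obtain ⟨e, h⟩ := h
      cases e
      exact ⟨_, .tyValue hW, rfl, h⟩
    | lam hV hU tU =>
      obtain ⟨e, h⟩ := h
      cases e
      obtain ⟨B', hB', hH⟩ := h.apply (.refl hU tU) rfl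
      cases W <;> simp only [applyVal, Option.some.injEq, reduceCtorEq] at hB'
      · subst hB'
        exact ⟨_, .lam hW hU tU hH.right_typed, rfl, hH⟩
      · subst hB'
        exact ⟨_, .fix hW hU tU hH.right_typed, rfl, hH⟩
    | fix hV hU tU =>
      obtain ⟨e, h⟩ := h
      cases e
      obtain ⟨B', hB', hH⟩ := h.apply (.refl hU tU) rfl
      cases W <;> simp only [applyVal, Option.some.injEq, reduceCtorEq] at hB'
      · subst hB'
        exact ⟨_, .lam hW hU tU hH.right_typed, rfl, hH⟩
      · subst hB'
        exact ⟨_, .fix hW hU tU hH.right_typed, rfl, hH⟩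
    | fst hV =>
      obtain ⟨e, h⟩ := h
      cases e
      obtain ⟨_, _, P', Q', e, rfl, h₁, h₂⟩ := h.pair
      cases e
      exact ⟨_, .fst hW h₁.right_typed, rfl, h₁⟩
    | snd hV =>
      obtain ⟨e, h⟩ := h
      cases e
      obtain ⟨_, _, P', Q', e, rfl, h₁, h₂⟩ := h.pair
      cases e
      exact ⟨_, .snd hW h₂.right_typed, rfl, h₂⟩
    | num hV =>
      obtain ⟨e, h⟩ := h
      cases e
      obtain rfl := h.num
      exact ⟨_, .num hW, rfl, h⟩
    | bool hV =>
      obtain ⟨e, h⟩ := h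
      cases e
      obtain rfl := h.bool
      exact ⟨_, .bool hW, rfl, h⟩
    | nil hV =>
      obtain ⟨e, h⟩ := h
      cases e
      obtain rfl := h.nil
      exact ⟨_, .nil hW, rfl, h⟩
    | hd hV =>
      obtain ⟨e, h⟩ := h
      cases e
      obtain ⟨_, P', Q', e, rfl, h₁, h₂⟩ := h.cons
      cases e
      exact ⟨_, .hd hW h₁.right_typed, rfl, h₁⟩
    | tl hV =>
      obtain ⟨e, h⟩ := h
      cases e
      obtain ⟨_, P', Q', e, rfl, h₁, h₂⟩ := h.cons
      cases e
      exact ⟨_, .tl hW h₂.right_typed, rfl, h₂⟩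

theorem HoweState.prob_le {s t : State S} (h : HoweState S s t) (l : Label S)
    (X : Set (State S)) :
    (chain S).prob s l X ≤ (chain S).prob t l {y | ∃ x ∈ X, HoweState S x y} := by
  by_cases hl : l = .eval → ∃ v, s = .inr v
  · exact prob_le_of_detStep hl (fun s' hs' => h.detStep hs') X
  · push Not at hl
    obtain ⟨rfl, hs⟩ := hl
    rcases s with ⟨⟨M, σ⟩, hM⟩ | v
    · rcases t with ⟨⟨N, τ⟩, hN⟩ | _
      · obtain ⟨e, h⟩ := h
        cases e
        exact HoweState.prob_eval_le hM hN h X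
      · exact h.elim
    · exact absurd rfl (hs v)

/-- Howe's lifting is not known to be transitive at this point, so its reflexive transitive closure
on states is taken as the simulation. -/
theorem Howe.closedSim {σ : Ty} {M N : Tm S.Op} (h : Howe S [] σ M N) : ClosedSim S σ M N := by
  refine ⟨h.left_typed, h.right_typed, Relation.ReflTransGen (HoweState S), ?_,
    .single ⟨rfl, h⟩⟩
  refine LMC.isSimulation_reflTransGen (C := chain S) fun s t hst l X => ?_
  refine (hst.prob_le l X).trans (LMC.prob_mono (C := chain S) t l ?_)
  rintro y ⟨x, hx, hxy⟩
  exact ⟨x, hx, .single hxy⟩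

/-- Substitutivity with the same closure on both sides reduces open terms to closed ones. -/
theorem Howe.sim {Γ : List Ty} {σ : Ty} {M N : Tm S.Op} (h : Howe S Γ σ M N) :
    (simPreorder S).rel Γ σ M N :=
  ⟨h.left_typed, h.right_typed, fun ξ hξ =>
    (h.subst (θ := ξ) (fun i τ hi => .refl (hξ i τ hi).2) hξ.isValueSub).closedSim⟩

theorem howeRel_eq_simPreorder (S : Signature) : howeRel S = simPreorder S := by
  have : (howeRel S).rel = (simPreorder S).rel := by
    funext Γ σ M N
    exact propext ⟨Howe.sim, Howe.of_sim⟩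
  cases h₁ : howeRel S
  cases h₂ : simPreorder S
  simp_all

theorem simPreorder_isPrecongruence (S : Signature) : (simPreorder S).IsPrecongruence :=
  ⟨simPreorder_trans, howeRel_eq_simPreorder S ▸ howeRel_isCompatible S⟩

theorem Howe.convProb_le {σ : Ty} {M N : Tm S.Op} (h : Howe S [] σ M N) :
    convProb S M ≤ convProb S N := by
  -- The expectation of the constant `1` is the total mass.
  simpa [convProb] using h.dominated 1 1 fun _ _ _ => le_rfl

theorem Howe.plug {Γ Δ : List Ty} {C : Ctx S.Op} {τ σ : Ty} (hC : CtxType S Γ C Δ τ σ)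
    {M N : Tm S.Op} (h : Howe S Δ τ M N) : Howe S Γ σ (C.plug M) (C.plug N) := by
  have c := howeRel_isCompatible S
  induction hC with
  | hole => exact h
  | lam _ ih => exact c.lam _ _ _ _ _ (ih h)
  | fix _ ih => exact c.fix _ _ _ _ _ (ih h)
  | appL _ t ih => exact c.app _ _ _ _ _ _ _ (ih h) (.refl t)
  | appR t _ ih => exact c.app _ _ _ _ _ _ _ (.refl t) (ih h)
  | choiceL _ t ih => exact c.choice _ _ _ _ _ _ (ih h) (.refl t)
  | choiceR t _ ih => exact c.choice _ _ _ _ _ _ (.refl t) (ih h)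
  | opL o _ t ih => exact c.op _ _ _ _ _ _ (ih h) (.refl t)
  | opR o t _ ih => exact c.op _ _ _ _ _ _ (.refl t) (ih h)
  | pairL _ t ih => exact c.pair _ _ _ _ _ _ _ (ih h) (.refl t)
  | pairR t _ ih => exact c.pair _ _ _ _ _ _ _ (.refl t) (ih h)
  | fst _ ih => exact c.fst _ _ _ _ _ (ih h)
  | snd _ ih => exact c.snd _ _ _ _ _ (ih h)
  | iteC _ t₁ t₂ ih => exact c.ite _ _ _ _ _ _ _ _ (ih h) (.refl t₁) (.refl t₂)
  | iteT t₁ _ t₂ ih => exact c.ite _ _ _ _ _ _ _ _ (.refl t₁) (ih h) (.refl t₂)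
  | iteE t₁ t₂ _ ih => exact c.ite _ _ _ _ _ _ _ _ (.refl t₁) (.refl t₂) (ih h)
  | consL _ t ih => exact c.cons _ _ _ _ _ _ (ih h) (.refl t)
  | consR t _ ih => exact c.cons _ _ _ _ _ _ (.refl t) (ih h)
  | caseL _ t₁ t₂ ih => exact c.caseList _ _ _ _ _ _ _ _ _ (ih h) (.refl t₁) (.refl t₂)
  | caseN t₁ _ t₂ ih => exact c.caseList _ _ _ _ _ _ _ _ _ (.refl t₁) (ih h) (.refl t₂)
  | caseC t₁ t₂ _ ih => exact c.caseList _ _ _ _ _ _ _ _ _ (.refl t₁) (.refl t₂) (ih h)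

theorem simPreorder_included (S : Signature) : (simPreorder S).Included (ctxPreorder S) :=
  fun _ _ _ _ h => ⟨h.1, h.2.1, fun _ _ hC => ((Howe.of_sim h).plug hC).convProb_le⟩

/-! ### Bisimulation equivalence -/

theorem closedBisim_iff {σ : Ty} {M N : Tm S.Op} :
    ClosedBisim S σ M N ↔ ClosedSim S σ M N ∧ ClosedSim S σ N M := by
  constructor
  · rintro ⟨hM, hN, h⟩
    have := LMC.bisimilar_iff.1 h
    exact ⟨⟨hM, hN, this.1⟩, ⟨hN, hM, this.2⟩⟩
  · rintro ⟨⟨hM, hN, h⟩, ⟨_, _, h'⟩⟩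
    exact ⟨hM, hN, LMC.bisimilar_iff.2 ⟨h, h'⟩⟩

/-- Mutual similarity passes through the quantification over closures, so every claim about
bisimulation equivalence follows from two uses of the one for the simulation preorder. -/
theorem bisimEquiv_iff {Γ : List Ty} {σ : Ty} {M N : Tm S.Op} :
    (bisimEquiv S).rel Γ σ M N ↔
      (simPreorder S).rel Γ σ M N ∧ (simPreorder S).rel Γ σ N M := by
  constructor
  · rintro ⟨hM, hN, h⟩
    exact ⟨⟨hM, hN, fun ξ hξ => (closedBisim_iff.1 (h ξ hξ)).1⟩,
      ⟨hN, hM, fun ξ hξ => (closedBisim_iff.1 (h ξ hξ)).2⟩⟩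
  · rintro ⟨⟨hM, hN, h⟩, ⟨_, _, h'⟩⟩
    exact ⟨hM, hN, fun ξ hξ => closedBisim_iff.2 ⟨h ξ hξ, h' ξ hξ⟩⟩

theorem bisimEquiv_isCompatible (S : Signature) : (bisimEquiv S).IsCompatible := by
  have c := (simPreorder_isPrecongruence S).2
  constructor <;> intros <;> simp only [bisimEquiv_iff] at *
  case var h => exact ⟨c.var _ _ _ h, c.var _ _ _ h⟩
  case num => exact ⟨c.num _ _, c.num _ _⟩
  case bool => exact ⟨c.bool _ _, c.bool _ _⟩
  case nil => exact ⟨c.nil _ _, c.nil _ _⟩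
  case pair h₁ h₂ =>
    exact ⟨c.pair _ _ _ _ _ _ _ h₁.1 h₂.1, c.pair _ _ _ _ _ _ _ h₁.2 h₂.2⟩
  case cons h₁ h₂ => exact ⟨c.cons _ _ _ _ _ _ h₁.1 h₂.1, c.cons _ _ _ _ _ _ h₁.2 h₂.2⟩
  case lam h => exact ⟨c.lam _ _ _ _ _ h.1, c.lam _ _ _ _ _ h.2⟩
  case fix h => exact ⟨c.fix _ _ _ _ _ h.1, c.fix _ _ _ _ _ h.2⟩
  case choice h₁ h₂ =>
    exact ⟨c.choice _ _ _ _ _ _ h₁.1 h₂.1, c.choice _ _ _ _ _ _ h₁.2 h₂.2⟩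
  case ite h₁ h₂ h₃ =>
    exact ⟨c.ite _ _ _ _ _ _ _ _ h₁.1 h₂.1 h₃.1, c.ite _ _ _ _ _ _ _ _ h₁.2 h₂.2 h₃.2⟩
  case op h₁ h₂ => exact ⟨c.op _ _ _ _ _ _ h₁.1 h₂.1, c.op _ _ _ _ _ _ h₁.2 h₂.2⟩
  case fst h => exact ⟨c.fst _ _ _ _ _ h.1, c.fst _ _ _ _ _ h.2⟩
  case snd h => exact ⟨c.snd _ _ _ _ _ h.1, c.snd _ _ _ _ _ h.2⟩
  case caseList h₁ h₂ h₃ =>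
    exact ⟨c.caseList _ _ _ _ _ _ _ _ _ h₁.1 h₂.1 h₃.1,
      c.caseList _ _ _ _ _ _ _ _ _ h₁.2 h₂.2 h₃.2⟩
  case app h₁ h₂ => exact ⟨c.app _ _ _ _ _ _ _ h₁.1 h₂.1, c.app _ _ _ _ _ _ _ h₁.2 h₂.2⟩

theorem bisimEquiv_isCongruence (S : Signature) : (bisimEquiv S).IsCongruence := by
  refine ⟨fun _ _ _ _ h => ?_, fun _ _ _ _ _ h h' => ?_, bisimEquiv_isCompatible S⟩
  · exact bisimEquiv_iff.2 (bisimEquiv_iff.1 h).symm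
  · rw [bisimEquiv_iff] at *
    exact ⟨simPreorder_trans _ _ _ _ _ h.1 h'.1, simPreorder_trans _ _ _ _ _ h'.2 h.2⟩

theorem bisimEquiv_included (S : Signature) : (bisimEquiv S).Included (ctxEquiv S) :=
  fun _ _ _ _ h => ⟨simPreorder_included S _ _ _ _ (bisimEquiv_iff.1 h).1,
    simPreorder_included S _ _ _ _ (bisimEquiv_iff.1 h).2⟩

end Main

end PCFL

theorem mainTheorem2 (S : PCFL.Signature) :
    ((PCFL.simPreorder S).IsPrecongruence ∧
      (PCFL.simPreorder S).Included (PCFL.ctxPreorder S)) ∧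
    ((PCFL.bisimEquiv S).IsCongruence ∧
      (PCFL.bisimEquiv S).Included (PCFL.ctxEquiv S)) :=
  ⟨⟨PCFL.simPreorder_isPrecongruence S, PCFL.simPreorder_included S⟩,
    ⟨PCFL.bisimEquiv_isCongruence S, PCFL.bisimEquiv_included S⟩⟩
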